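/- Let $L>0$ and let $\rho,a\in BV(0,L)$ satisfy $0<\rho_0\le\rho(x)\le\rho_1$ and $0<a_0\le a(x)\le a_1$ for a.e. $x\in(0,L)$. Put $\beta=\operatorname{ess\,sup}_{(0,L)}\sqrt{\rho/a}$ and let $L\beta<T<\infty$. Here $H^{-1}(c,d)$ denotes the dual of $H^1_0(c,d)$, where $H^1_0(c,d)$ is the closure of $C_c^\infty(c,d)$ in the norm $\|\varphi\|^2=\int|\varphi|^2+\int|\varphi'|^2$. For $s\in H^{-1}(0,T)$ consider the adjoint system $$\rho(x)\psi_{tt}-(a(x)\psi_x)_x=0\ \text{ in }(0,L)\times(0,T),\qquad \psi(x,T)=\psi_t(x,T)=0,\qquad \psi_x(0,t)=0,\quad \psi_x(L,t)=s(t).$$ A weak solution is a function $\psi\in L^2((0,L)\times(0,T))$ such that $$\int_0^T\!\!\int_0^L \psi\,\big(\rho\, w\,\eta''-(a w')'\,\eta\big)\,dx\,dt=a(L^-)\,\big\langle s,\,w(L)\eta\big\rangle$$ for all $w$ with $w$ and $aw'$ absolutely continuous on $[0,L]$, $(aw')'\in L^2(0,L)$, $(aw')(0)=(aw')(L)=0$,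 and all $\eta\in C^\infty(\mathbb R)$ with support in $(0,\infty)$, such that $w(L)\eta|_{(0,T)}\in H^1_0(0,T)$, i.e. $w(L)\eta(T)=0$. (The test functions $\eta$ are otherwise free at $t=T$; this encodes the final conditions.) Its trace $\psi(0,\cdot)\in L^2(0,T)$ is the weak limit in $L^2(0,T)$ of $\varepsilon^{-1}\int_0^\varepsilon\psi(x,\cdot)\,dx$ as $\varepsilon\to0^+$. Then there is a constant $C>0$, depending only on $a$, $\rho$, $L$ and $T$, such that $$\|s\|_{H^{-1}(L\beta,T)}\le C\,\|\psi(0,\cdot)\|_{L^2(0,T)}$$ for every $s\in H^{-1}(0,T)$ supported in $[L\beta,T]$ and every weak solution $\psi$ of the adjoint system that has a trace $\psi(0,\cdot)\in L^2(0,T)$. -/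

import Mathlib

open MeasureTheory Set Filter Topology
open scoped ContDiff

noncomputable section

/-- The real Hilbert space `L²(ℝ)`. -/
abbrev L2Line : Type := Lp ℝ 2 (volume : Measure ℝ)

/-- `L²(ℝ) × L²(ℝ)` with the Hilbert norm `‖(u, v)‖² = ‖u‖² + ‖v‖²`.  A function `u ∈ H¹(ℝ)` is
represented by the pair `(u, u')`, whose norm is then exactly the `H¹` norm of `u`. -/
abbrev L2Pair : Type := WithLp 2 (L2Line × L2Line)

/-- The pairs `(φ, φ')` with `φ ∈ C_c^∞(c, d)`. -/
def smoothPairs (c d : ℝ) : Set L2Pair :=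
  {p | ∃ φ : ℝ → ℝ, ContDiff ℝ ∞ φ ∧ HasCompactSupport φ ∧ tsupport φ ⊆ Ioo c d ∧
    (p.fst : ℝ → ℝ) =ᵐ[volume] φ ∧ (p.snd : ℝ → ℝ) =ᵐ[volume] deriv φ}

/-- The Sobolev space `H¹₀(c, d)`: the closure of `C_c^∞(c, d)` in the `H¹` norm (its elements are
extended by zero to `ℝ`; the set of pairs `(φ, φ')` is already a linear subspace, so taking the
span adds nothing). -/
def H10 (c d : ℝ) : Submodule ℝ L2Pair :=
  (Submodule.span ℝ (smoothPairs c d)).topologicalClosure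

/-- `H⁻¹(c, d)`: the dual of `H¹₀(c, d)`, with the dual norm. -/
abbrev HNegOne (c d : ℝ) : Type := StrongDual ℝ (H10 c d)

/-- For `s ∈ H⁻¹(0, T)` and `0 ≤ τ`, the norm in `H⁻¹(τ, T)` of (the restriction to `(τ, T)` of)
`s`, that is the norm of `s` as a functional on `H¹₀(τ, T) ⊆ H¹₀(0, T)`. -/
def hNegOneNormOn {T : ℝ} (s : HNegOne 0 T) (τ : ℝ) : ℝ :=
  ‖s.comp ((H10 τ T).comap (H10 0 T).subtype).subtypeL‖

/-- The distribution `s ∈ H⁻¹(0, T)` vanishes on `(0, τ)`, i.e. its support lies in `[τ, T]`. -/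
def SupportedAfter {T : ℝ} (s : HNegOne 0 T) (τ : ℝ) : Prop :=
  ∀ φ : H10 0 T, (φ : L2Pair) ∈ H10 0 τ → s φ = 0

/-- `β = ess sup_{(0, L)} √(ρ / a)`. -/
def slowness (L : ℝ) (ρ a : ℝ → ℝ) : ℝ :=
  essSup (fun x => √(ρ x / a x)) (volume.restrict (Ioo 0 L))

/-- `w` lies in the domain of the Neumann operator `w ↦ (a w')'` on `(0, L)`, and `(a w')' = f`:
the function `f` is in `L²(0, L)`, the flux `a w'` is the primitive of `f` that vanishes at `0`, it
also vanishes at `L`, and `w` is a primitive of `(a w') / a`. -/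
structure IsNeumannTest (L : ℝ) (a w f : ℝ → ℝ) : Prop where
  memLp : MemLp f 2 (volume.restrict (Ioo 0 L))
  flux_right : ∫ y in (0 : ℝ)..L, f y = 0
  eq_primitive : ∀ x ∈ Icc 0 L, w x = w 0 + ∫ z in (0 : ℝ)..x, (∫ y in (0 : ℝ)..z, f y) / a z

/-- `ψ = ψ(x, t)` is a weak solution (by transposition) of
  `ρ ψ_tt - (a ψ_x)_x = 0` in `(0, L) × (0, T)`, `ψ(·, T) = ψ_t(·, T) = 0`,
  `ψ_x(0, ·) = 0`, `ψ_x(L, ·) = s`, with `s ∈ H⁻¹(0, T)`.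

The test functions are `w(x) η(t)`, with `w` in the domain of the Neumann operator and `η` smooth
and vanishing near `t = 0`.  Neither `η` nor `η'` has to vanish at `t = T`, and this encodes the two
final conditions.  The only restriction is that the trace `φ = w(L) η` at `x = L` of the test
function be in `H¹₀(0, T)`, as it must for the pairing `⟨s, φ⟩` to make sense (so `η(T) = 0` or
`w(L) = 0`).  Multiplying the equation by `w η` and integrating by parts twice in `x` and in `t`
gives the identity below; the coefficient `a` at `x = L` is the left limit `a(L⁻)`. -/
structure IsAdjointSolution (L T : ℝ) (ρ a : ℝ → ℝ) (s : HNegOne 0 T) (ψ : ℝ → ℝ → ℝ) :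
    Prop where
  memLp : MemLp (fun p : ℝ × ℝ => ψ p.1 p.2) 2 (volume.restrict (Ioo 0 L ×ˢ Ioo 0 T))
  weak_eq : ∀ w f η : ℝ → ℝ, IsNeumannTest L a w f →
    ContDiff ℝ ∞ η → tsupport η ⊆ Ioi 0 →
    ∀ φ : H10 0 T,
      ((φ : L2Pair).fst : ℝ → ℝ) =ᵐ[volume.restrict (Ioo 0 T)] (fun t => w L * η t) →
      ∫ p in Ioo 0 L ×ˢ Ioo 0 T,
          ψ p.1 p.2 * (ρ p.1 * w p.1 * deriv (deriv η) p.2 - f p.1 * η p.2)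
        = Function.leftLim a L * s φ

/-- `h ∈ L²(0, T)` is the trace `ψ(0, ·)`: the averages `ε⁻¹ ∫₀^ε ψ(x, ·) dx` converge to `h` weakly
in `L²(0, T)` as `ε → 0⁺`. -/
structure IsTraceAtZero (T : ℝ) (ψ : ℝ → ℝ → ℝ) (h : ℝ → ℝ) : Prop where
  memLp : MemLp h 2 (volume.restrict (Ioo 0 T))
  tendsto : ∀ η : ℝ → ℝ, MemLp η 2 (volume.restrict (Ioo 0 T)) →
    Tendsto (fun ε : ℝ => ε⁻¹ * ∫ p in Ioo 0 ε ×ˢ Ioo 0 T, ψ p.1 p.2 * η p.2) (𝓝[>] 0)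
      (𝓝 (∫ t in Ioo 0 T, h t * η t))

end

/-! The proof is a sidewise energy estimate: `x` plays the role of time, and the solution is
propagated from `x = 0`, where the Neumann condition leaves only the trace `h`, to `x = L`, where
the flux is the source.

With `P = ψ`, `Q` a time primitive of the flux `a ψ_x`, and `α = 1/a`, the equation reads `P_x = α
Q_t`, `Q_x = r P_t`, with `Q = 0` at `x = 0`. For constant coefficients the energy `∫ (r P² + α Q²)
dt` over `(xβ, T)` has `x`-derivative `-β (r P² + α Q²) - 2 r α P Q`, evaluated at `t = xβ`; the
endpoint `T` contributes nothing because `P` vanishes there. Since `2 r α |P Q| ≤ √(r α) (r P² + α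
Q²)` and `√(r α) ≤ β`, the energy decreases. Hence `Q(L, ·)` is controlled in `L²(Lβ, T)` by `h`. As
`a(L⁻) s` is the time derivative of `Q(L, ·)`, one integration by parts bounds `s` in `H⁻¹(Lβ, T)`.

Two obstacles remain. The coefficients are only BV, so there is no derivative in `x`: the weight
`exp(-V)`, with `V` dominating their relative variation, makes both weighted coefficients
nonincreasing, and the remaining errors, of size `(y - x)` times an increment of a monotone
function, disappear under subdivision (`le_of_increment_le`). The solution is only `L²`: it is
averaged in time against kernels supported in `(0, ∞)`, which are admissible test functions and
preserve the vanishing at `T`. The constant does not depend on the kernel, so the kernel can be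
shrunk to a point at the end.

The main steps are `IsAdjointSolution.exists_pairing_eq` (weak form to integral equation),
`exists_isSidewiseSolution` (regularized system), `IsSidewiseSolution.integral_sq_le` (energy
estimate) and `sq_leftLim_mul_le` (duality). -/

/-! ### Calculus preliminaries. -/

/-- Integration by parts for primitives of integrable functions. -/
theorem integral_primitive_mul {u v : ℝ → ℝ} {L : ℝ}
    (hu : IntervalIntegrable u volume 0 L) (hv : IntervalIntegrable v volume 0 L) :
    ∫ x in (0 : ℝ)..L, (∫ y in (0 : ℝ)..x, u y) * v x
      = (∫ y in (0 : ℝ)..L, u y) * (∫ y in (0 : ℝ)..L, v y)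
        - ∫ x in (0 : ℝ)..L, u x * ∫ y in (0 : ℝ)..x, v y := by
  have key := AbsolutelyContinuousOnInterval.integral_mul_deriv_eq_deriv_mul
    (hu.absolutelyContinuousOnInterval_intervalIntegral left_mem_uIcc)
    (hv.absolutelyContinuousOnInterval_intervalIntegral left_mem_uIcc)
  have e1 : ∫ x in (0 : ℝ)..L, (∫ y in (0 : ℝ)..x, u y) * v x
      = ∫ x in (0 : ℝ)..L, (∫ y in (0 : ℝ)..x, u y) * deriv (fun x => ∫ y in (0 : ℝ)..x, v y) x := by
    apply intervalIntegral.integral_congr_ae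
    filter_upwards [hv.ae_hasDerivAt_integral] with x hx hx'
    rw [(hx (uIoc_subset_uIcc hx') 0 left_mem_uIcc).deriv]
  have e2 : ∫ x in (0 : ℝ)..L, u x * (∫ y in (0 : ℝ)..x, v y)
      = ∫ x in (0 : ℝ)..L, deriv (fun x => ∫ y in (0 : ℝ)..x, u y) x * (∫ y in (0 : ℝ)..x, v y) := by
    apply intervalIntegral.integral_congr_ae
    filter_upwards [hu.ae_hasDerivAt_integral] with x hx hx'
    rw [(hx (uIoc_subset_uIcc hx') 0 left_mem_uIcc).deriv]
  rw [e1, e2, key]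
  simp

/-- An integrable function that is orthogonal to every bounded measurable function of mean zero is
constant almost everywhere. -/
theorem ae_eq_const_of_forall_integral_mul_eq_zero {u : ℝ → ℝ} {L : ℝ} (hL : 0 < L)
    (hu : IntegrableOn u (Ioo 0 L))
    (h : ∀ f : ℝ → ℝ, Measurable f → (∀ x, |f x| ≤ 1) → ∫ x in Ioo 0 L, f x = 0 →
      ∫ x in Ioo 0 L, f x * u x = 0) :
    ∃ c, ∀ᵐ x ∂volume.restrict (Ioo 0 L), u x = c := by
  set c := L⁻¹ * ∫ x in Ioo 0 L, u x
  refine ⟨c, ?_⟩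
  have hvol : volume.real (Ioo 0 L) = L := by simp [Measure.real, hL.le]
  have : (fun x => u x - c) =ᵐ[volume.restrict (Ioo 0 L)] 0 := by
    refine Integrable.ae_eq_zero_of_forall_setIntegral_eq_zero
      (hu.sub (integrable_const c)) (fun s hs _ => ?_)
    -- The test function is the indicator of `s` minus its mean `θ`. As `0 ≤ θ ≤ 1`, it takes values
    -- in `[-1, 1]`.
    set θ := L⁻¹ * ∫ x in Ioo 0 L, s.indicator (fun _ => (1:ℝ)) x with hθ
    have hind : IntegrableOn (s.indicator (fun _ => (1:ℝ))) (Ioo 0 L) :=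
      (integrable_const (1:ℝ)).indicator hs
    have hθ0 : 0 ≤ θ := by
      refine mul_nonneg (inv_nonneg.2 hL.le) (integral_nonneg fun x => ?_)
      exact indicator_nonneg (fun _ _ => zero_le_one) x
    have hθ1 : θ ≤ 1 := by
      have : ∫ x in Ioo 0 L, s.indicator (fun _ => (1:ℝ)) x ≤ ∫ x in Ioo 0 L, (1:ℝ) := by
        refine integral_mono hind (integrable_const _) (fun x => ?_)
        exact indicator_le_self' (fun _ _ => zero_le_one) x
      rw [setIntegral_const, hvol] at this
      rw [hθ, inv_mul_le_iff₀ hL]; simpa using this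
    have h1 := h (fun x => s.indicator (fun _ => (1:ℝ)) x - θ)
      ((measurable_const.indicator hs).sub_const _)
      (fun x => by
        by_cases hx : x ∈ s
        · simp only [indicator_of_mem hx]; rw [abs_le]; constructor <;> linarith
        · simp only [indicator_of_notMem hx]; rw [abs_le]; constructor <;> linarith)
      (by
        rw [integral_sub hind (integrable_const _), setIntegral_const, hvol, hθ]
        simp; field_simp; ring)
    have e : ∀ x, (s.indicator (fun _ => (1:ℝ)) x - θ) * u x = s.indicator u x - θ * u x := by
      intro x
      by_cases hx : x ∈ s
      · simp [hx]; ring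
      · simp [hx]
    simp only [e] at h1
    rw [integral_sub (hu.indicator hs) (hu.const_mul _), integral_const_mul] at h1
    have e2 : ∫ x in s, (u x - c) ∂volume.restrict (Ioo 0 L)
        = ∫ x in Ioo 0 L, s.indicator (fun x => u x - c) x := (integral_indicator hs).symm
    rw [e2]
    have e3 : ∀ x, s.indicator (fun x => u x - c) x
        = s.indicator u x - c * s.indicator (fun _ => (1:ℝ)) x := by
      intro x
      by_cases hx : x ∈ s <;> simp [hx]
    simp only [e3]
    rw [integral_sub (hu.indicator hs) (hind.const_mul _), integral_const_mul]
    have e4 : c * ∫ x in Ioo 0 L, s.indicator (fun _ => (1:ℝ)) x = θ * ∫ x in Ioo 0 L, u x := by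
      simp only [c, θ]; ring
    rw [e4]; exact h1
  filter_upwards [this] with x hx
  simpa [sub_eq_zero] using hx

/-- A function on a dense set of parameters whose increments are bounded above by
`(y - x) * (W y - W x)` is nonincreasing. -/
theorem le_of_increment_le {G : Set ℝ} {E W : ℝ → ℝ} {a b : ℝ}
    (hdense : ∀ x y, a < x → x < y → y < b → ∃ z ∈ G, x < z ∧ z < y)
    (hG : G ⊆ Ioo a b)
    (hE : ∀ x ∈ G, ∀ y ∈ G, x < y → E y - E x ≤ (y - x) * (W y - W x))
    (hW : ∀ x ∈ G, ∀ y ∈ G, x < y → W x ≤ W y)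
    {x y : ℝ} (hx : x ∈ G) (hy : y ∈ G) (hxy : x < y) : E y ≤ E x := by
  have step : ∀ n : ℕ, ∀ x ∈ G, ∀ y ∈ G, x < y →
      E y - E x ≤ (2 / 3 : ℝ) ^ n * ((y - x) * (W y - W x)) := by
    intro n
    induction n with
    | zero => intro x hx y hy hxy; simpa using hE x hx y hy hxy
    | succ n ih =>
      intro x hx y hy hxy
      -- A point of the middle third makes both pieces shorter than two thirds of the interval,
      -- while the increments of `W` add up: each bisection gains a factor `2/3`.
      obtain ⟨z, hz, hz1, hz2⟩ := hdense (x + (y - x) / 3) (y - (y - x) / 3)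
        (by linarith [(hG hx).1]) (by linarith) (by linarith [(hG hy).2])
      have h1 := ih x hx z hz (by linarith)
      have h2 := ih z hz y hy (by linarith)
      have w1 := hW x hx z hz (by linarith)
      have w2 := hW z hz y hy (by linarith)
      have p : (0 : ℝ) ≤ (2 / 3) ^ n := by positivity
      have k1 : (z - x) * (W z - W x) ≤ 2 / 3 * (y - x) * (W z - W x) :=
        mul_le_mul_of_nonneg_right (by linarith) (by linarith)
      have k2 : (y - z) * (W y - W z) ≤ 2 / 3 * (y - x) * (W y - W z) :=
        mul_le_mul_of_nonneg_right (by linarith) (by linarith)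
      have := mul_le_mul_of_nonneg_left (add_le_add k1 k2) p
      rw [pow_succ]
      linarith
  have lim : Tendsto (fun n : ℕ => (2 / 3 : ℝ) ^ n * ((y - x) * (W y - W x))) atTop
      (𝓝 (0 * ((y - x) * (W y - W x)))) :=
    (tendsto_pow_atTop_nhds_zero_of_lt_one (by norm_num) (by norm_num)).mul_const _
  rw [zero_mul] at lim
  have := ge_of_tendsto' lim (fun n => step n x hx y hy hxy)
  linarith

/-- Differentiation of `t ↦ ∫ g(p) k(τ(p) - t) dp`. -/
theorem hasDerivAt_integral_mul_comp_sub {X : Type*} [MeasurableSpace X] {μ : Measure X}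
    {g τ : X → ℝ} {k : ℝ → ℝ} (hg : Integrable g μ) (hτ : Measurable τ)
    (hk : ContDiff ℝ ∞ k) (hkc : HasCompactSupport k) (t : ℝ) :
    HasDerivAt (fun t => ∫ p, g p * k (τ p - t) ∂μ) (-∫ p, g p * deriv k (τ p - t) ∂μ) t := by
  have hk' : Continuous (deriv k) := hk.continuous_deriv (by simp)
  obtain ⟨C, hC⟩ := hkc.deriv.exists_bound_of_continuous hk'
  obtain ⟨C0, hC0⟩ := hkc.exists_bound_of_continuous hk.continuous
  have m : ∀ (k : ℝ → ℝ), Continuous k → ∀ t, AEStronglyMeasurable (fun p => g p * k (τ p - t)) μ :=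
    fun k hk t => hg.aestronglyMeasurable.mul
      (hk.measurable.comp (hτ.sub_const t)).aestronglyMeasurable
  have := (hasDerivAt_integral_of_dominated_loc_of_deriv_le (μ := μ)
    (F := fun t p => g p * k (τ p - t)) (F' := fun t p => -(g p * deriv k (τ p - t)))
    (bound := fun p => |g p| * C) (x₀ := t) (s := univ) univ_mem
    (Eventually.of_forall fun t => m k hk.continuous t)
    (hg.mul_bdd (c := C0) (hk.continuous.measurable.comp (hτ.sub_const t)).aestronglyMeasurable
      (Eventually.of_forall fun p => hC0 _))
    (m _ hk' t).neg
    (Eventually.of_forall fun p t _ => by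
      rw [norm_neg, norm_mul]
      exact mul_le_mul_of_nonneg_left (hC _) (abs_nonneg _))
    (hg.abs.mul_const C)
    (Eventually.of_forall fun p t _ => by
      have h1 : HasDerivAt k (deriv k (τ p - t)) (τ p - t) :=
        (hk.differentiable (by simp) _).hasDerivAt
      have := (h1.comp t ((hasDerivAt_id t).const_sub (τ p))).const_mul (g p)
      simpa using this)).2
  rwa [integral_neg] at this

/-! ### Coefficients of bounded variation. -/

/-- The increments of a function of bounded variation are dominated by those of a bounded monotone
function. -/
theorem BoundedVariationOn.exists_dominating_monotone {f : ℝ → ℝ} {s : Set ℝ}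
    (hf : BoundedVariationOn f s) :
    ∃ v : ℝ → ℝ, (∀ x, 0 ≤ v x) ∧ (∃ B, ∀ x, v x ≤ B) ∧
      ∀ x ∈ s, ∀ y ∈ s, x ≤ y → |f y - f x| ≤ v y - v x := by
  have fin : ∀ t ⊆ s, eVariationOn f t ≠ ⊤ := fun t ht => hf.mono ht
  refine ⟨fun x => (eVariationOn f (s ∩ Iic x)).toReal, fun x => ENNReal.toReal_nonneg,
    ⟨(eVariationOn f s).toReal, fun x => ENNReal.toReal_mono hf
      (eVariationOn.mono f inter_subset_left)⟩, fun x hx y hy hxy => ?_⟩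
  have h1 : eVariationOn f (s ∩ Iic x) + eVariationOn f (s ∩ Icc x y)
      ≤ eVariationOn f (s ∩ Iic y) := by
    refine (eVariationOn.add_le_union f fun p hp q hq => le_trans hp.2 hq.2.1).trans ?_
    apply eVariationOn.mono
    rintro p (hp | hp)
    · exact ⟨hp.1, le_trans hp.2 hxy⟩
    · exact ⟨hp.1, hp.2.2⟩
  have h2 := (hf.mono (inter_subset_left (t := Icc x y))).dist_le
    ⟨hy, hxy, le_rfl⟩ ⟨hx, le_rfl, hxy⟩
  have h3 := ENNReal.toReal_mono (fin _ inter_subset_left) h1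
  rw [ENNReal.toReal_add (fin _ inter_subset_left) (fin _ inter_subset_left)] at h3
  rw [Real.dist_eq] at h2
  linarith

theorem BoundedVariationOn.aemeasurable_restrict {f : ℝ → ℝ} {s : Set ℝ}
    (hf : BoundedVariationOn f s) (hs : MeasurableSet s) :
    AEMeasurable f (volume.restrict s) := by
  obtain ⟨p, q, hp, hq, rfl⟩ :=
    hf.locallyBoundedVariationOn.exists_monotoneOn_sub_monotoneOn
  exact (aemeasurable_restrict_of_monotoneOn hs hp).sub (aemeasurable_restrict_of_monotoneOn hs hq)

/-- An a.e. bounded, a.e. measurable function has a measurable representative that satisfies the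
bounds everywhere. -/
theorem exists_measurable_representative {f : ℝ → ℝ} {s : Set ℝ} {c d : ℝ} (hcd : c ≤ d)
    (hf : AEMeasurable f (volume.restrict s))
    (hb : ∀ᵐ x ∂volume.restrict s, c ≤ f x ∧ f x ≤ d) :
    ∃ g : ℝ → ℝ, Measurable g ∧ (∀ x, c ≤ g x ∧ g x ≤ d) ∧
      ∀ᵐ x ∂volume.restrict s, g x = f x := by
  refine ⟨fun x => max c (min d (hf.mk f x)), measurable_const.max
    (measurable_const.min hf.measurable_mk), fun x => ⟨le_max_left _ _, max_le hcd
    (min_le_left _ _)⟩, ?_⟩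
  filter_upwards [hb, hf.ae_eq_mk] with x hx hx'
  rw [← hx', min_eq_right hx.2, max_eq_right hx.1]

theorem ae_sqrt_div_le_slowness {L ρ₀ ρ₁ a₀ a₁ : ℝ} {ρ a : ℝ → ℝ}
    (hρ₀ : 0 < ρ₀) (ha₀ : 0 < a₀)
    (hρ : ∀ᵐ x ∂(volume.restrict (Ioo 0 L)), ρ₀ ≤ ρ x ∧ ρ x ≤ ρ₁)
    (ha : ∀ᵐ x ∂(volume.restrict (Ioo 0 L)), a₀ ≤ a x ∧ a x ≤ a₁) :
    ∀ᵐ x ∂(volume.restrict (Ioo 0 L)), √(ρ x / a x) ≤ slowness L ρ a := by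
  refine ae_le_essSup ⟨√(ρ₁ / a₀), ?_⟩
  rw [eventually_map]
  filter_upwards [hρ, ha] with x h1 h2
  exact Real.sqrt_le_sqrt (div_le_div₀ (by linarith) h1.2 ha₀ h2.1)

theorem exists_of_ae_restrict_Ioo {P : ℝ → Prop} {c d : ℝ} (hcd : c < d)
    (h : ∀ᵐ x ∂volume.restrict (Ioo c d), P x) : ∃ x ∈ Ioo c d, P x := by
  by_contra! H
  rw [ae_restrict_iff' measurableSet_Ioo] at h
  have : (Ioo c d) ⊆ {x | ¬ (x ∈ Ioo c d → P x)} := fun x hx => by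
    exact fun h => H x hx (h hx)
  have h0 : volume (Ioo c d) = 0 := measure_mono_null this h
  rw [Real.volume_Ioo] at h0
  simp at h0; linarith

/-- Regular representatives of the coefficients `ρ` and `1 / a`, with a monotone function that
dominates their relative variations. -/
theorem exists_coefficients {L ρ₀ ρ₁ a₀ a₁ : ℝ} {ρ a : ℝ → ℝ}
    (hL : 0 < L) (hρ₀ : 0 < ρ₀) (ha₀ : 0 < a₀)
    (hρBV : BoundedVariationOn ρ (Ioo 0 L)) (haBV : BoundedVariationOn a (Ioo 0 L))
    (hρ : ∀ᵐ x ∂(volume.restrict (Ioo 0 L)), ρ₀ ≤ ρ x ∧ ρ x ≤ ρ₁)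
    (ha : ∀ᵐ x ∂(volume.restrict (Ioo 0 L)), a₀ ≤ a x ∧ a x ≤ a₁) :
    ∃ (r α V : ℝ → ℝ) (G : Set ℝ) (B : ℝ), Measurable r ∧ Measurable α ∧
      (∀ x, ρ₀ ≤ r x ∧ r x ≤ ρ₁) ∧ (∀ x, a₁⁻¹ ≤ α x ∧ α x ≤ a₀⁻¹) ∧
      (∀ᵐ x ∂(volume.restrict (Ioo 0 L)), r x = ρ x) ∧
      (∀ᵐ x ∂(volume.restrict (Ioo 0 L)), α x = (a x)⁻¹) ∧
      G ⊆ Ioo 0 L ∧ (∀ᵐ x ∂(volume.restrict (Ioo 0 L)), x ∈ G) ∧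
      (∀ x, 0 ≤ V x ∧ V x ≤ B) ∧ (∀ x ∈ G, √(r x * α x) ≤ slowness L ρ a) ∧
      ∀ x ∈ G, ∀ y ∈ G, x ≤ y →
        |r y - r x| ≤ ρ₀ * (V y - V x) ∧ |α y - α x| ≤ a₁⁻¹ * (V y - V x) := by
  obtain ⟨x₀, -, ⟨h1, h2⟩, h3, h4⟩ := exists_of_ae_restrict_Ioo hL (hρ.and ha)
  have ha₁ : 0 < a₁ := by linarith
  obtain ⟨r, rm, rb, re⟩ := exists_measurable_representative (h1.trans h2)
    (hρBV.aemeasurable_restrict measurableSet_Ioo) hρ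
  obtain ⟨α, αm, αb, αe⟩ := exists_measurable_representative (c := a₁⁻¹) (d := a₀⁻¹)
    (f := fun x => (a x)⁻¹) (s := Ioo 0 L) (inv_anti₀ ha₀ (h3.trans h4))
    (haBV.aemeasurable_restrict measurableSet_Ioo).inv (by
      filter_upwards [ha] with x hx
      exact ⟨inv_anti₀ (by linarith) hx.2, inv_anti₀ ha₀ hx.1⟩)
  obtain ⟨v, v0, ⟨vB, hvB⟩, hv⟩ := hρBV.exists_dominating_monotone
  obtain ⟨u, u0, ⟨uB, huB⟩, hu⟩ := haBV.exists_dominating_monotone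
  -- The weights make the variation relative to the lower bounds `ρ₀` and `a₁⁻¹`: the increments of
  -- `1/a` are at most `a₀⁻²` times those of `a`, and division by `a₁⁻¹` gives the factor `a₁ a₀⁻²`.
  refine ⟨r, α, fun x => ρ₀⁻¹ * v x + a₁ * (a₀⁻¹ * a₀⁻¹) * u x,
    {x | x ∈ Ioo 0 L ∧ r x = ρ x ∧ α x = (a x)⁻¹ ∧ a₀ ≤ a x ∧ √(ρ x / a x) ≤ slowness L ρ a},
    ρ₀⁻¹ * vB + a₁ * (a₀⁻¹ * a₀⁻¹) * uB, rm, αm, rb, αb, re, αe, fun x hx => hx.1, ?_, ?_, ?_, ?_⟩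
  · filter_upwards [re, αe, ha, ae_sqrt_div_le_slowness hρ₀ ha₀ hρ ha,
      ae_restrict_mem measurableSet_Ioo] with x h1 h2 h3 h4 h5
    exact ⟨h5, h1, h2, h3.1, h4⟩
  · intro x
    have := v0 x; have := u0 x; have := hvB x; have := huB x
    exact ⟨by positivity, add_le_add
      (mul_le_mul_of_nonneg_left (hvB x) (by positivity))
      (mul_le_mul_of_nonneg_left (huB x) (by positivity))⟩
  · rintro x ⟨-, hr, hα, -, hs⟩
    rwa [hr, hα, ← div_eq_mul_inv]
  · rintro x ⟨hx, hr, hα, hax, -⟩ y ⟨hy, hr', hα', hay, -⟩ hxy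
    have k1 := hv x hx y hy hxy
    have k2 := hu x hx y hy hxy
    have k3 : 0 ≤ v y - v x := (abs_nonneg _).trans k1
    have k4 : 0 ≤ u y - u x := (abs_nonneg _).trans k2
    constructor
    · rw [hr, hr']
      have : ρ₀ * (ρ₀⁻¹ * v y + a₁ * (a₀⁻¹ * a₀⁻¹) * u y - (ρ₀⁻¹ * v x + a₁ * (a₀⁻¹ * a₀⁻¹) * u x))
          = (v y - v x) + ρ₀ * (a₁ * (a₀⁻¹ * a₀⁻¹) * (u y - u x)) := by field_simp; ring
      rw [this]
      have : 0 ≤ ρ₀ * (a₁ * (a₀⁻¹ * a₀⁻¹) * (u y - u x)) := by positivity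
      linarith
    · rw [hα, hα']
      have : a₁⁻¹ * (ρ₀⁻¹ * v y + a₁ * (a₀⁻¹ * a₀⁻¹) * u y - (ρ₀⁻¹ * v x + a₁ * (a₀⁻¹ * a₀⁻¹) * u x))
          = (a₀⁻¹ * a₀⁻¹) * (u y - u x) + a₁⁻¹ * (ρ₀⁻¹ * (v y - v x)) := by field_simp; ring
      rw [this]
      have p1 : 0 ≤ a₁⁻¹ * (ρ₀⁻¹ * (v y - v x)) := by positivity
      have hax' : 0 < a x := ha₀.trans_le hax
      have hay' : 0 < a y := ha₀.trans_le hay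
      have e : (a y)⁻¹ - (a x)⁻¹ = ((a y)⁻¹ * (a x)⁻¹) * (a x - a y) := by field_simp
      rw [e, abs_mul, abs_of_pos (by positivity), abs_sub_comm]
      have : (a y)⁻¹ * (a x)⁻¹ * |a y - a x| ≤ (a₀⁻¹ * a₀⁻¹) * (u y - u x) := by gcongr
      linarith

/-- Bounded variation provides the left limit, and every left neighbourhood of `L` contains points
where the a.e. bound holds. Positivity of `a(L⁻)` allows the final division. -/
theorem le_leftLim_of_ae_le {L a₀ : ℝ} {a : ℝ → ℝ} (hL : 0 < L)
    (haBV : BoundedVariationOn a (Ioo 0 L))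
    (ha : ∀ᵐ x ∂(volume.restrict (Ioo 0 L)), a₀ ≤ a x) : a₀ ≤ Function.leftLim a L := by
  obtain ⟨l, hl⟩ := haBV.exists_tendsto_left L
  have e : 𝓝[Ioo 0 L ∩ Iio L] L = 𝓝[<] L := by
    rw [inter_eq_left.2 (fun x hx => hx.2), nhdsWithin_Ioo_eq_nhdsLT hL]
  rw [e] at hl
  have ht := tendsto_leftLim_of_tendsto ⟨l, hl⟩
  refine ge_of_tendsto_of_frequently ht ?_
  rw [frequently_iff]
  intro U hU
  obtain ⟨c, hc, hcU⟩ := (mem_nhdsLT_iff_exists_Ioo_subset' hL).1 hU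
  obtain ⟨x, hx, hxa⟩ := exists_of_ae_restrict_Ioo (c := max 0 c) (d := L) (max_lt hL hc)
    (ae_restrict_of_ae_restrict_of_subset (Ioo_subset_Ioo_left (le_max_left _ _)) ha)
  exact ⟨x, hcU ⟨(le_max_right _ _).trans_lt hx.1, hx.2⟩, hxa⟩

/-! ### From the weak formulation to integral equations in `x`. -/

noncomputable section

/-- The function `x ↦ ∫₀ᵀ ψ(x, t) η(t) dt`, extended by zero outside `(0, L)`. -/
def pairing (L T : ℝ) (ψ : ℝ → ℝ → ℝ) (η : ℝ → ℝ) : ℝ → ℝ :=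
  (Ioo 0 L).indicator fun x => ∫ t in Ioo 0 T, ψ x t * η t

/-- The primitive of `r` times the pairing of `ψ` with `η`. -/
def pairingFlux (L T : ℝ) (r : ℝ → ℝ) (ψ : ℝ → ℝ → ℝ) (η : ℝ → ℝ) (x : ℝ) : ℝ :=
  ∫ z in (0 : ℝ)..x, r z * pairing L T ψ η z

theorem volume_restrict_prod (s t : Set ℝ) :
    (volume : Measure (ℝ × ℝ)).restrict (s ×ˢ t)
      = (volume.restrict s).prod (volume.restrict t) := by
  rw [Measure.volume_eq_prod, Measure.prod_restrict]

theorem Continuous.exists_bound_Icc {η : ℝ → ℝ} (hη : Continuous η) (c d : ℝ) :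
    ∃ C, ∀ t ∈ Icc c d, |η t| ≤ C :=
  isCompact_Icc.exists_bound_of_continuousOn hη.continuousOn

variable {L T : ℝ} {ψ : ℝ → ℝ → ℝ}

theorem integrable_mul_tensor {g η : ℝ → ℝ} {C : ℝ}
    (hψ : Integrable (fun p : ℝ × ℝ => ψ p.1 p.2) (volume.restrict (Ioo 0 L ×ˢ Ioo 0 T)))
    (hg : Measurable g) (hgC : ∀ x ∈ Ioo 0 L, |g x| ≤ C) (hη : Continuous η) :
    Integrable (fun p : ℝ × ℝ => ψ p.1 p.2 * (g p.1 * η p.2))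
      (volume.restrict (Ioo 0 L ×ˢ Ioo 0 T)) := by
  obtain ⟨D, hD⟩ := hη.exists_bound_Icc 0 T
  refine hψ.mul_bdd (c := C * D) ((hg.comp measurable_fst).mul
    (hη.measurable.comp measurable_snd)).aestronglyMeasurable ?_
  filter_upwards [ae_restrict_mem (measurableSet_Ioo.prod measurableSet_Ioo)] with p hp
  rw [norm_mul]
  have h1 := hgC _ hp.1
  exact mul_le_mul h1 (hD _ (Ioo_subset_Icc_self hp.2)) (norm_nonneg _)
    ((abs_nonneg _).trans h1)

theorem integrable_pairing {η : ℝ → ℝ}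
    (hψ : Integrable (fun p : ℝ × ℝ => ψ p.1 p.2) (volume.restrict (Ioo 0 L ×ˢ Ioo 0 T)))
    (hη : Continuous η) : Integrable (pairing L T ψ η) := by
  have h := integrable_mul_tensor (g := fun _ => 1) (C := 1) hψ measurable_const (by simp) hη
  rw [volume_restrict_prod] at h
  have := h.integral_prod_left
  simp only [one_mul] at this
  exact (integrable_indicator_iff measurableSet_Ioo).2 this

theorem setIntegral_mul_tensor {g η : ℝ → ℝ} {C : ℝ}
    (hψ : Integrable (fun p : ℝ × ℝ => ψ p.1 p.2) (volume.restrict (Ioo 0 L ×ˢ Ioo 0 T)))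
    (hg : Measurable g) (hgC : ∀ x ∈ Ioo 0 L, |g x| ≤ C) (hη : Continuous η) :
    ∫ p in Ioo 0 L ×ˢ Ioo 0 T, ψ p.1 p.2 * (g p.1 * η p.2)
      = ∫ x in Ioo 0 L, g x * pairing L T ψ η x := by
  have h := integrable_mul_tensor hψ hg hgC hη
  rw [volume_restrict_prod] at h ⊢
  rw [integral_prod _ h]
  refine setIntegral_congr_fun measurableSet_Ioo fun x hx => ?_
  simp only [pairing, indicator_of_mem hx]
  rw [← integral_const_mul]
  congr 1; ext t; ring

theorem setIntegral_Ioo_eq_intervalIntegral {f : ℝ → ℝ} {c d : ℝ} (h : c ≤ d) :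
    ∫ x in Ioo c d, f x = ∫ x in c..d, f x := by
  rw [intervalIntegral.integral_of_le h, integral_Ioc_eq_integral_Ioo]

theorem integrable_mul_pairing {r η : ℝ → ℝ} {r₁ : ℝ}
    (hψ : Integrable (fun p : ℝ × ℝ => ψ p.1 p.2) (volume.restrict (Ioo 0 L ×ˢ Ioo 0 T)))
    (hr : Measurable r) (hr₁ : ∀ x, |r x| ≤ r₁) (hη : Continuous η) :
    Integrable fun x => r x * pairing L T ψ η x :=
  (integrable_pairing hψ hη).bdd_mul hr.aestronglyMeasurable (Eventually.of_forall hr₁)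

theorem continuous_pairingFlux {r η : ℝ → ℝ} {r₁ : ℝ}
    (hψ : Integrable (fun p : ℝ × ℝ => ψ p.1 p.2) (volume.restrict (Ioo 0 L ×ˢ Ioo 0 T)))
    (hr : Measurable r) (hr₁ : ∀ x, |r x| ≤ r₁) (hη : Continuous η) :
    Continuous (pairingFlux L T r ψ η) :=
  intervalIntegral.continuous_primitive
    (fun _ _ => (integrable_mul_pairing hψ hr hr₁ hη).intervalIntegrable) 0

theorem intervalIntegrable_mul_continuous {α f : ℝ → ℝ} {α₁ : ℝ}
    (hα : Measurable α) (hα₁ : ∀ x, |α x| ≤ α₁) (hf : Continuous f) (c d : ℝ) :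
    IntervalIntegrable (fun x => α x * f x) volume c d :=
  ⟨(hf.intervalIntegrable c d).1.bdd_mul hα.aestronglyMeasurable (Eventually.of_forall hα₁),
    (hf.intervalIntegrable c d).2.bdd_mul hα.aestronglyMeasurable (Eventually.of_forall hα₁)⟩

/-- The pairing of a weak solution with a smooth function of time satisfies the sidewise equation,
up to a constant of integration. -/
theorem IsAdjointSolution.exists_pairing_eq {s : HNegOne 0 T} {ρ a r α η : ℝ → ℝ} {r₁ α₁ : ℝ}
    (hL : 0 < L) (h : IsAdjointSolution L T ρ a s ψ)
    (hr : Measurable r) (hr₁ : ∀ x, |r x| ≤ r₁) (hα : Measurable α) (hα₁ : ∀ x, |α x| ≤ α₁)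
    (hrρ : ∀ᵐ x ∂(volume.restrict (Ioo 0 L)), r x = ρ x)
    (hαa : ∀ᵐ x ∂(volume.restrict (Ioo 0 L)), α x = (a x)⁻¹)
    (hη : ContDiff ℝ ∞ η) (hη0 : tsupport η ⊆ Ioi 0) :
    ∃ c, ∀ᵐ x ∂(volume.restrict (Ioo 0 L)), pairing L T ψ η x
      = c + ∫ z in (0 : ℝ)..x, α z * pairingFlux L T r ψ (deriv (deriv η)) z := by
  have hψ : Integrable (fun p : ℝ × ℝ => ψ p.1 p.2) (volume.restrict (Ioo 0 L ×ˢ Ioo 0 T)) := by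
    have : IsFiniteMeasure ((volume : Measure (ℝ × ℝ)).restrict (Ioo 0 L ×ˢ Ioo 0 T)) := by
      rw [volume_restrict_prod]; infer_instance
    exact h.memLp.integrable one_le_two
  have hηc := hη.continuous
  have hη2 : Continuous (deriv (deriv η)) := by
    have h1 : ContDiff ℝ ∞ (deriv η) := ((contDiff_infty_iff_deriv (𝕜 := ℝ)).1 hη).2
    exact h1.continuous_deriv (by simp)
  set N := pairingFlux L T r ψ (deriv (deriv η)) with hN
  have hNc : Continuous N := continuous_pairingFlux hψ hr hr₁ hη2
  set G : ℝ → ℝ := fun x => ∫ z in (0 : ℝ)..x, α z * N z with hG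
  have hGc : Continuous G := intervalIntegral.continuous_primitive
    (fun c d => intervalIntegrable_mul_continuous hα hα₁ hNc c d) 0
  have hGi : IntegrableOn G (Ioo 0 L) :=
    (hGc.integrableOn_Icc (a := 0) (b := L)).mono_set Ioo_subset_Icc_self
  -- Du Bois-Reymond argument: each bounded `f` of mean zero is the image `(a w')'` of some Neumann
  -- test function `w`.
  obtain ⟨c, hc⟩ := ae_eq_const_of_forall_integral_mul_eq_zero
    (u := fun x => pairing L T ψ η x - G x) hL ((integrable_pairing hψ hηc).integrableOn.sub hGi) (by
    intro f hf hf1 hf0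
    have hfi : ∀ c d, IntervalIntegrable f volume c d := fun c d => by
      simpa using intervalIntegrable_mul_continuous hf hf1 continuous_const (f := fun _ => (1 : ℝ)) c d
    set F : ℝ → ℝ := fun z => ∫ y in (0 : ℝ)..z, f y with hF
    have hFc : Continuous F := intervalIntegral.continuous_primitive hfi 0
    have hαF := fun c d => intervalIntegrable_mul_continuous hα hα₁ hFc c d
    -- The free additive constant in `w` is fixed by `w L = 0`. The trace of the test function is
    -- then zero, so the source drops out and `η` is unrestricted at `T`.
    set w : ℝ → ℝ := fun x => -(∫ z in (0 : ℝ)..L, α z * F z) + ∫ z in (0 : ℝ)..x, α z * F z with hw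
    have hwc : Continuous w :=
      continuous_const.add (intervalIntegral.continuous_primitive hαF 0)
    have hwL : w L = 0 := by simp [hw]
    have hfL : ∫ y in (0 : ℝ)..L, f y = 0 := by
      rw [← setIntegral_Ioo_eq_intervalIntegral hL.le]; exact hf0
    have htest : IsNeumannTest L a w f := by
      refine ⟨MemLp.of_bound hf.aestronglyMeasurable 1 (Eventually.of_forall hf1), hfL, ?_⟩
      intro x hx
      have : ∫ z in (0 : ℝ)..x, α z * F z = ∫ z in (0 : ℝ)..x, (∫ y in (0 : ℝ)..z, f y) / a z := by
        rw [← setIntegral_Ioo_eq_intervalIntegral hx.1, ← setIntegral_Ioo_eq_intervalIntegral hx.1]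
        apply integral_congr_ae
        filter_upwards [ae_restrict_of_ae_restrict_of_subset (Ioo_subset_Ioo_right hx.2) hαa]
          with z hz
        rw [hz, div_eq_mul_inv, mul_comm]
      simp [hw, this]
    have hweak := h.weak_eq w f η htest hη hη0 0 (by
      rw [hwL]
      have : ((0 : H10 0 T) : L2Pair).fst = 0 := rfl
      rw [this]
      filter_upwards [ae_restrict_of_ae (Lp.coeFn_zero ℝ 2 (volume : Measure ℝ))] with t ht
      simp)
    rw [map_zero, mul_zero] at hweak
    obtain ⟨Cw, hCw⟩ := hwc.exists_bound_Icc 0 L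
    have hrw : ∀ x ∈ Ioo 0 L, |r x * w x| ≤ r₁ * Cw := fun x hx => by
      rw [abs_mul]
      exact mul_le_mul (hr₁ x) (hCw x (Ioo_subset_Icc_self hx)) (abs_nonneg _)
        ((abs_nonneg _).trans (hr₁ x))
    have e1 : ∫ p in Ioo 0 L ×ˢ Ioo 0 T,
          ψ p.1 p.2 * (ρ p.1 * w p.1 * deriv (deriv η) p.2 - f p.1 * η p.2)
        = ∫ p in Ioo 0 L ×ˢ Ioo 0 T, (ψ p.1 p.2 * ((r p.1 * w p.1) * deriv (deriv η) p.2)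
          - ψ p.1 p.2 * (f p.1 * η p.2)) := by
      apply integral_congr_ae
      rw [volume_restrict_prod]
      have := Measure.quasiMeasurePreserving_fst
        (μ := volume.restrict (Ioo 0 L)) (ν := volume.restrict (Ioo 0 T)) |>.ae hrρ
      filter_upwards [this] with p hp
      rw [hp]; ring
    rw [e1, integral_sub (integrable_mul_tensor hψ (g := fun x => r x * w x)
        (hr.mul hwc.measurable) hrw hη2)
      (integrable_mul_tensor hψ hf (fun x _ => hf1 x) hηc),
      setIntegral_mul_tensor hψ (g := fun x => r x * w x) (hr.mul hwc.measurable) hrw hη2,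
      setIntegral_mul_tensor hψ hf (fun x _ => hf1 x) hηc] at hweak
    have hni := integrable_mul_pairing (L := L) (T := T) hψ hr hr₁ hη2
    -- Two integrations by parts move both primitives from `f` to the pairing. The boundary terms
    -- vanish by `w L = 0` and by the zero mean of `f`.
    have e2 : ∫ x in Ioo 0 L, r x * w x * pairing L T ψ (deriv (deriv η)) x
        = ∫ x in Ioo 0 L, f x * G x := by
      rw [setIntegral_Ioo_eq_intervalIntegral hL.le, setIntegral_Ioo_eq_intervalIntegral hL.le]
      have p1 := integral_primitive_mul (hαF 0 L) (hni.intervalIntegrable (a := 0) (b := L))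
      have p2 := integral_primitive_mul (hfi 0 L)
        (intervalIntegrable_mul_continuous hα hα₁ hNc 0 L)
      have e3 : ∫ x in (0 : ℝ)..L, r x * w x * pairing L T ψ (deriv (deriv η)) x
          = ∫ x in (0 : ℝ)..L, (-(∫ z in (0 : ℝ)..L, α z * F z)
              * (r x * pairing L T ψ (deriv (deriv η)) x)
            + (∫ z in (0 : ℝ)..x, α z * F z) * (r x * pairing L T ψ (deriv (deriv η)) x)) := by
        congr 1; ext x; simp only [hw]; ring
      rw [e3, intervalIntegral.integral_add (hni.intervalIntegrable.const_mul _)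
        (hni.intervalIntegrable.continuousOn_mul
          (intervalIntegral.continuous_primitive hαF 0).continuousOn),
        intervalIntegral.integral_const_mul, p1]
      have e4 : ∫ x in (0 : ℝ)..L, α x * F x * N x = ∫ x in (0 : ℝ)..L, F x * (α x * N x) := by
        congr 1; ext x; ring
      rw [hfL] at p2
      simp only [show ∀ x, ∫ y in (0 : ℝ)..x, r y * pairing L T ψ (deriv (deriv η)) y = N x
        from fun _ => rfl]
      rw [e4, p2]
      simp only [hG]
      ring
    rw [e2] at hweak
    have e5 : ∀ x, f x * (pairing L T ψ η x - G x) = f x * pairing L T ψ η x - f x * G x :=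
      fun x => mul_sub _ _ _
    simp only [e5]
    rw [integral_sub (integrable_mul_pairing hψ hf hf1 hηc).integrableOn
      (hGi.bdd_mul hf.aestronglyMeasurable (Eventually.of_forall hf1))]
    linarith)
  refine ⟨c, ?_⟩
  filter_upwards [hc] with x hx
  linarith

end

noncomputable section

variable {L T : ℝ} {ψ : ℝ → ℝ → ℝ}

theorem pairing_eqOn_of_le {ε : ℝ} (hε : ε ≤ L) (η : ℝ → ℝ) {x : ℝ} (hx : x ∈ Ioo 0 ε) :
    pairing ε T ψ η x = pairing L T ψ η x := by
  simp only [pairing, indicator_of_mem hx, indicator_of_mem (Ioo_subset_Ioo_right hε hx)]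

theorem integrable_restrict_left {ε : ℝ} (hε : ε ≤ L)
    (hψ : Integrable (fun p : ℝ × ℝ => ψ p.1 p.2) (volume.restrict (Ioo 0 L ×ˢ Ioo 0 T))) :
    Integrable (fun p : ℝ × ℝ => ψ p.1 p.2) (volume.restrict (Ioo 0 ε ×ˢ Ioo 0 T)) :=
  IntegrableOn.mono_set hψ (prod_mono (Ioo_subset_Ioo_right hε) Subset.rfl)

/-- The mean values of the pairing near `x = 0` converge to the pairing with the trace. -/
theorem IsTraceAtZero.const_eq {h η G : ℝ → ℝ} {c : ℝ} (hL : 0 < L)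
    (hψ : Integrable (fun p : ℝ × ℝ => ψ p.1 p.2) (volume.restrict (Ioo 0 L ×ˢ Ioo 0 T)))
    (htr : IsTraceAtZero T ψ h) (hη : Continuous η) (hG : Continuous G) (hG0 : G 0 = 0)
    (hc : ∀ᵐ x ∂(volume.restrict (Ioo 0 L)), pairing L T ψ η x = c + G x) :
    c = ∫ t in Ioo 0 T, h t * η t := by
  obtain ⟨D, hD⟩ := hη.exists_bound_Icc 0 T
  have hmem : MemLp η 2 (volume.restrict (Ioo 0 T)) :=
    MemLp.of_bound hη.aestronglyMeasurable D (by
      filter_upwards [ae_restrict_mem measurableSet_Ioo] with t ht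
      exact hD t (Ioo_subset_Icc_self ht))
  refine tendsto_nhds_unique ?_ (htr.tendsto η hmem)
  -- The averages of `c + G` over `(0, ε)` are difference quotients of its primitive and tend to `c
  -- + G 0 = c`; by definition of the trace they also tend to the pairing with `h`.
  have hd : HasDerivAt (fun ε => ∫ x in (0 : ℝ)..ε, (c + G x)) (c + G 0) 0 :=
    intervalIntegral.integral_hasDerivAt_right (by simp)
      (continuous_const.add hG).aestronglyMeasurable.stronglyMeasurableAtFilter
      (continuous_const.add hG).continuousAt
  have hs := (hasDerivAt_iff_tendsto_slope_zero.1 hd).mono_left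
    (nhdsWithin_mono (0 : ℝ) (fun x (hx : 0 < x) => ne_of_gt hx))
  rw [hG0, add_zero] at hs
  refine hs.congr' ?_
  filter_upwards [Ioo_mem_nhdsGT hL] with ε hε
  simp only [zero_add, intervalIntegral.integral_same, sub_zero, smul_eq_mul]
  congr 1
  have e := setIntegral_mul_tensor (g := fun _ => 1) (C := 1)
    (integrable_restrict_left hε.2.le hψ) measurable_const (by simp) hη
  simp only [one_mul] at e
  rw [e, ← setIntegral_Ioo_eq_intervalIntegral hε.1.le]
  apply integral_congr_ae
  filter_upwards [ae_restrict_of_ae_restrict_of_subset (Ioo_subset_Ioo_right hε.2.le) hc,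
    ae_restrict_mem measurableSet_Ioo] with x hx hxε
  rw [pairing_eqOn_of_le hε.2.le η hxε, hx]

/-- The boundary value of the flux is the pairing with the boundary source. -/
theorem IsAdjointSolution.pairingFlux_right {s : HNegOne 0 T} {ρ a r η : ℝ → ℝ} {r₁ : ℝ}
    (hL : 0 < L) (h : IsAdjointSolution L T ρ a s ψ)
    (hψ : Integrable (fun p : ℝ × ℝ => ψ p.1 p.2) (volume.restrict (Ioo 0 L ×ˢ Ioo 0 T)))
    (hr : Measurable r) (hr₁ : ∀ x, |r x| ≤ r₁)
    (hrρ : ∀ᵐ x ∂(volume.restrict (Ioo 0 L)), r x = ρ x)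
    (hη : ContDiff ℝ ∞ η) (hη0 : tsupport η ⊆ Ioi 0) (φ : H10 0 T)
    (hφ : ((φ : L2Pair).fst : ℝ → ℝ) =ᵐ[volume.restrict (Ioo 0 T)] η) :
    pairingFlux L T r ψ (deriv (deriv η)) L = Function.leftLim a L * s φ := by
  have hη2 : Continuous (deriv (deriv η)) := by
    have h1 : ContDiff ℝ ∞ (deriv η) := ((contDiff_infty_iff_deriv (𝕜 := ℝ)).1 hη).2
    exact h1.continuous_deriv (by simp)
  -- The constant `w = 1` isolates the source: only the `ρ ψ η''` term survives, and its integral is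
  -- the flux at `L`.
  have htest : IsNeumannTest L a (fun _ => 1) (fun _ => 0) :=
    ⟨MemLp.zero, by simp, fun x _ => by simp⟩
  rw [← h.weak_eq _ _ η htest hη hη0 φ (by simpa using hφ), pairingFlux,
    ← setIntegral_Ioo_eq_intervalIntegral hL.le,
    ← setIntegral_mul_tensor hψ hr (fun x _ => hr₁ x) hη2]
  apply integral_congr_ae
  rw [volume_restrict_prod]
  have := Measure.quasiMeasurePreserving_fst
    (μ := volume.restrict (Ioo 0 L)) (ν := volume.restrict (Ioo 0 T)) |>.ae hrρ
  filter_upwards [this] with p hp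
  rw [hp]; ring

/-! ### Regularization in time. -/

/-- The flux of `ψ` regularized in time by the kernel `k`. -/
def mollFlux (L T : ℝ) (r : ℝ → ℝ) (ψ : ℝ → ℝ → ℝ) (k : ℝ → ℝ) (x t : ℝ) : ℝ :=
  pairingFlux L T r ψ (fun τ => k (τ - t)) x

/-- The regularization of `ψ` in time by the kernel `k`, expressed by its trace `h` at `x = 0` and
its flux. -/
def mollValue (L T : ℝ) (r α : ℝ → ℝ) (ψ : ℝ → ℝ → ℝ) (h : ℝ → ℝ) (k : ℝ → ℝ) (x t : ℝ) : ℝ :=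
  (∫ τ in Ioo 0 T, h τ * k (τ - t))
    + ∫ z in (0 : ℝ)..x, α z * mollFlux L T r ψ (deriv (deriv k)) z t

/-- Smooth compactly supported kernels on `(0, ∞)`. -/
structure IsKernel (k : ℝ → ℝ) : Prop where
  contDiff : ContDiff ℝ ∞ k
  hasCompactSupport : HasCompactSupport k
  tsupport_subset : tsupport k ⊆ Ioi 0

theorem IsKernel.deriv {k : ℝ → ℝ} (hk : IsKernel k) : IsKernel (deriv k) :=
  ⟨((contDiff_infty_iff_deriv (𝕜 := ℝ)).1 hk.contDiff).2, hk.hasCompactSupport.deriv,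
    (tsupport_deriv_subset (𝕜 := ℝ)).trans hk.tsupport_subset⟩

theorem IsKernel.eq_zero {k : ℝ → ℝ} (hk : IsKernel k) {t : ℝ} (ht : t ≤ 0) : k t = 0 :=
  image_eq_zero_of_notMem_tsupport fun h => absurd (hk.tsupport_subset h) (not_lt.2 ht)

theorem IsKernel.exists_bound {k : ℝ → ℝ} (hk : IsKernel k) : ∃ C, ∀ t, |k t| ≤ C :=
  hk.hasCompactSupport.exists_bound_of_continuous hk.contDiff.continuous

theorem IsKernel.continuous_sub {k : ℝ → ℝ} (hk : IsKernel k) (t : ℝ) :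
    Continuous fun τ => k (τ - t) := hk.contDiff.continuous.comp (continuous_sub_right t)

theorem IsKernel.contDiff_sub {k : ℝ → ℝ} (hk : IsKernel k) (t : ℝ) :
    ContDiff ℝ ∞ fun τ => k (τ - t) := hk.contDiff.comp (contDiff_id.sub contDiff_const)

/-- Averaging only over later times keeps the translated kernel admissible in the weak formulation
for every `t ≥ 0`, up to and including `T`. -/
theorem IsKernel.tsupport_sub {k : ℝ → ℝ} (hk : IsKernel k) {t : ℝ} (ht : 0 ≤ t) :
    tsupport (fun τ => k (τ - t)) ⊆ Ioi 0 := by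
  have h1 : tsupport (fun τ => k (τ - t)) ⊆ (fun τ => τ - t) ⁻¹' tsupport k :=
    closure_minimal (fun τ hτ => subset_tsupport k hτ)
      ((isClosed_tsupport k).preimage (continuous_sub_right t))
  intro τ hτ
  have : 0 < τ - t := hk.tsupport_subset (h1 hτ)
  exact lt_of_le_of_lt ht (by linarith)

theorem deriv_deriv_comp_sub (k : ℝ → ℝ) (t : ℝ) :
    deriv (deriv fun τ => k (τ - t)) = fun τ => deriv (deriv k) (τ - t) := by
  have : ∀ g : ℝ → ℝ, deriv (fun τ => g (τ - t)) = fun τ => deriv g (τ - t) := fun g => by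
    ext τ; exact deriv_comp_sub_const g t τ
  rw [this, this]

variable {r α h k : ℝ → ℝ} {r₁ α₁ : ℝ}

/-- As a space-time integral the flux depends on `t` only through the kernel, so it can be
differentiated and bounded under the integral sign. -/
theorem mollFlux_eq_setIntegral
    (hψ : Integrable (fun p : ℝ × ℝ => ψ p.1 p.2) (volume.restrict (Ioo 0 L ×ˢ Ioo 0 T)))
    (hr : Measurable r) (hr₁ : ∀ x, |r x| ≤ r₁) (hk : IsKernel k) {x : ℝ} (hx : x ∈ Icc 0 L)
    (t : ℝ) :
    mollFlux L T r ψ k x t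
      = ∫ p in Ioo 0 x ×ˢ Ioo 0 T, (ψ p.1 p.2 * r p.1) * k (p.2 - t) := by
  rw [mollFlux, pairingFlux, ← setIntegral_Ioo_eq_intervalIntegral hx.1]
  simp only [mul_assoc]
  rw [setIntegral_mul_tensor (integrable_restrict_left hx.2 hψ) hr (fun z _ => hr₁ z)
    (hk.continuous_sub t)]
  refine setIntegral_congr_fun measurableSet_Ioo fun z hz => ?_
  simp only [pairing_eqOn_of_le hx.2 _ hz]

theorem integrable_mul_coeff
    (hψ : Integrable (fun p : ℝ × ℝ => ψ p.1 p.2) (volume.restrict (Ioo 0 L ×ˢ Ioo 0 T)))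
    (hr : Measurable r) (hr₁ : ∀ x, |r x| ≤ r₁) {x : ℝ} (hx : x ≤ L) :
    Integrable (fun p : ℝ × ℝ => ψ p.1 p.2 * r p.1) (volume.restrict (Ioo 0 x ×ˢ Ioo 0 T)) :=
  (integrable_restrict_left hx hψ).mul_bdd (hr.comp measurable_fst).aestronglyMeasurable
    (Eventually.of_forall fun p => hr₁ p.1)

theorem hasDerivAt_mollFlux
    (hψ : Integrable (fun p : ℝ × ℝ => ψ p.1 p.2) (volume.restrict (Ioo 0 L ×ˢ Ioo 0 T)))
    (hr : Measurable r) (hr₁ : ∀ x, |r x| ≤ r₁) (hk : IsKernel k) {x : ℝ} (hx : x ∈ Icc 0 L)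
    (t : ℝ) :
    HasDerivAt (mollFlux L T r ψ k x) (-mollFlux L T r ψ (deriv k) x t) t := by
  have e : mollFlux L T r ψ k x
      = fun t => ∫ p in Ioo 0 x ×ˢ Ioo 0 T, (ψ p.1 p.2 * r p.1) * k (p.2 - t) :=
    funext fun t => mollFlux_eq_setIntegral hψ hr hr₁ hk hx t
  rw [e, mollFlux_eq_setIntegral hψ hr hr₁ hk.deriv hx]
  exact hasDerivAt_integral_mul_comp_sub (integrable_mul_coeff hψ hr hr₁ hx.2) measurable_snd
    hk.contDiff hk.hasCompactSupport t

theorem exists_bound_mollFlux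
    (hψ : Integrable (fun p : ℝ × ℝ => ψ p.1 p.2) (volume.restrict (Ioo 0 L ×ˢ Ioo 0 T)))
    (hr : Measurable r) (hr₁ : ∀ x, |r x| ≤ r₁) (hk : IsKernel k) :
    ∃ M, ∀ x ∈ Icc 0 L, ∀ t, |mollFlux L T r ψ k x t| ≤ M := by
  obtain ⟨C, hC⟩ := hk.exists_bound
  have hC0 : 0 ≤ C := (abs_nonneg _).trans (hC 0)
  refine ⟨∫ p in Ioo 0 L ×ˢ Ioo 0 T, |ψ p.1 p.2 * r p.1| * C, fun x hx t => ?_⟩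
  rw [mollFlux_eq_setIntegral hψ hr hr₁ hk hx, ← Real.norm_eq_abs]
  have hi := (integrable_mul_coeff hψ hr hr₁ le_rfl).abs.mul_const C
  refine (norm_integral_le_of_norm_le (hi.mono_measure (Measure.restrict_mono
    (prod_mono (Ioo_subset_Ioo_right hx.2) Subset.rfl) le_rfl)) ?_).trans ?_
  · refine Eventually.of_forall fun p => ?_
    rw [norm_mul]
    exact mul_le_mul_of_nonneg_left (hC _) (norm_nonneg _)
  · exact setIntegral_mono_set hi (Eventually.of_forall fun p => by positivity)
      (prod_mono (Ioo_subset_Ioo_right hx.2) Subset.rfl).eventuallyLE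

theorem continuous_mollFlux
    (hψ : Integrable (fun p : ℝ × ℝ => ψ p.1 p.2) (volume.restrict (Ioo 0 L ×ˢ Ioo 0 T)))
    (hr : Measurable r) (hr₁ : ∀ x, |r x| ≤ r₁) (hk : IsKernel k) (t : ℝ) :
    Continuous fun x => mollFlux L T r ψ k x t :=
  continuous_pairingFlux hψ hr hr₁ (hk.continuous_sub t)

theorem hasDerivAt_mollValue
    (hψ : Integrable (fun p : ℝ × ℝ => ψ p.1 p.2) (volume.restrict (Ioo 0 L ×ˢ Ioo 0 T)))
    (hr : Measurable r) (hr₁ : ∀ x, |r x| ≤ r₁) (hα : Measurable α) (hα₁ : ∀ x, |α x| ≤ α₁)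
    (hh : IntegrableOn h (Ioo 0 T)) (hk : IsKernel k) {x : ℝ} (hx : x ∈ Icc 0 L) (t : ℝ) :
    HasDerivAt (mollValue L T r α ψ h k x) (-mollValue L T r α ψ h (deriv k) x t) t := by
  have h1 : HasDerivAt (fun t => ∫ τ in Ioo 0 T, h τ * k (τ - t))
      (-∫ τ in Ioo 0 T, h τ * deriv k (τ - t)) t :=
    hasDerivAt_integral_mul_comp_sub (τ := id) hh measurable_id hk.contDiff hk.hasCompactSupport t
  obtain ⟨M, hM⟩ := exists_bound_mollFlux hψ hr hr₁ hk.deriv.deriv.deriv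
  have hc := fun (k : ℝ → ℝ) (hk : IsKernel k) (t : ℝ) => intervalIntegrable_mul_continuous hα hα₁
    (continuous_mollFlux hψ hr hr₁ hk t) 0 x
  have hx' : ∀ z ∈ uIoc 0 x, z ∈ Icc 0 L := fun z hz => by
    rw [uIoc_of_le hx.1] at hz
    exact ⟨hz.1.le, hz.2.trans hx.2⟩
  have h2 := (intervalIntegral.hasDerivAt_integral_of_dominated_loc_of_deriv_le (μ := volume)
    (a := 0) (b := x) (F := fun t z => α z * mollFlux L T r ψ (deriv (deriv k)) z t)
    (F' := fun t z => α z * -mollFlux L T r ψ (deriv (deriv (deriv k))) z t)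
    (bound := fun _ => α₁ * M) (x₀ := t) (s := univ) univ_mem
    (Eventually.of_forall fun t => by
      have := (hc _ hk.deriv.deriv t).def'
      exact this.aestronglyMeasurable)
    (hc _ hk.deriv.deriv t)
    (by
      have := (hc _ hk.deriv.deriv.deriv t).def'.aestronglyMeasurable.neg
      refine this.congr (Eventually.of_forall fun z => ?_)
      simp)
    (Eventually.of_forall fun z hz t _ => by
      rw [norm_mul, norm_neg]
      exact mul_le_mul (hα₁ z) (hM z (hx' z hz) t) (norm_nonneg _) ((abs_nonneg _).trans (hα₁ z)))
    (by simp)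
    (Eventually.of_forall fun z hz t _ =>
      (hasDerivAt_mollFlux hψ hr hr₁ hk.deriv.deriv (hx' z hz) t).const_mul (α z))).2
  convert! h1.add h2 using 1
  simp only [mollValue, mul_neg, intervalIntegral.integral_neg]
  ring

theorem exists_bound_mollValue
    (hψ : Integrable (fun p : ℝ × ℝ => ψ p.1 p.2) (volume.restrict (Ioo 0 L ×ˢ Ioo 0 T)))
    (hr : Measurable r) (hr₁ : ∀ x, |r x| ≤ r₁) (hα₁ : ∀ x, |α x| ≤ α₁)
    (hh : IntegrableOn h (Ioo 0 T)) (hk : IsKernel k) :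
    ∃ M, ∀ x ∈ Icc 0 L, ∀ t, |mollValue L T r α ψ h k x t| ≤ M := by
  obtain ⟨C, hC⟩ := hk.exists_bound
  obtain ⟨M, hM⟩ := exists_bound_mollFlux hψ hr hr₁ hk.deriv.deriv
  refine ⟨(∫ τ in Ioo 0 T, |h τ| * C) + α₁ * M * L, fun x hx t => ?_⟩
  have hM0 : 0 ≤ M := (abs_nonneg _).trans (hM x hx t)
  have hα0 : 0 ≤ α₁ := (abs_nonneg _).trans (hα₁ 0)
  refine (abs_add_le _ _).trans (add_le_add ?_ ?_)
  · rw [← Real.norm_eq_abs]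
    refine norm_integral_le_of_norm_le (hh.abs.mul_const C) (Eventually.of_forall fun τ => ?_)
    rw [norm_mul]
    exact mul_le_mul_of_nonneg_left (hC _) (norm_nonneg _)
  · rw [← Real.norm_eq_abs]
    refine (intervalIntegral.norm_integral_le_of_norm_le_const (C := α₁ * M) fun z hz => ?_).trans ?_
    · rw [uIoc_of_le hx.1] at hz
      rw [norm_mul]
      exact mul_le_mul (hα₁ z) (hM z ⟨hz.1.le, hz.2.trans hx.2⟩ t) (norm_nonneg _) hα0
    · rw [sub_zero, abs_of_nonneg hx.1]
      exact mul_le_mul_of_nonneg_left hx.2 (by positivity)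

/-- At time `T` the kernel sees only `τ > T`, outside the range of integration. This is how the
final conditions enter the energy argument. -/
theorem mollFlux_right_eq_zero (hk : IsKernel k) (x : ℝ) : mollFlux L T r ψ k x T = 0 := by
  have : ∀ z, pairing L T ψ (fun τ => k (τ - T)) z = 0 := fun z => by
    by_cases hz : z ∈ Ioo 0 L
    · rw [pairing, indicator_of_mem hz, setIntegral_eq_zero_of_forall_eq_zero]
      intro t ht
      rw [hk.eq_zero (by linarith [ht.2]), mul_zero]
    · rw [pairing, indicator_of_notMem hz]
  simp [mollFlux, pairingFlux, this]

theorem mollValue_right_eq_zero (hk : IsKernel k) (x : ℝ) : mollValue L T r α ψ h k x T = 0 := by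
  simp only [mollValue, mollFlux_right_eq_zero hk.deriv.deriv, mul_zero,
    intervalIntegral.integral_zero, add_zero]
  refine setIntegral_eq_zero_of_forall_eq_zero fun t ht => ?_
  rw [hk.eq_zero (by linarith [ht.2]), mul_zero]

/-- For a weak solution with trace `h` the flux is the primitive of the regularized solution. -/
theorem mollFlux_eq_integral_mollValue {s : HNegOne 0 T} {ρ a : ℝ → ℝ}
    (hL : 0 < L) (hsol : IsAdjointSolution L T ρ a s ψ) (htr : IsTraceAtZero T ψ h)
    (hψ : Integrable (fun p : ℝ × ℝ => ψ p.1 p.2) (volume.restrict (Ioo 0 L ×ˢ Ioo 0 T)))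
    (hr : Measurable r) (hr₁ : ∀ x, |r x| ≤ r₁) (hα : Measurable α) (hα₁ : ∀ x, |α x| ≤ α₁)
    (hrρ : ∀ᵐ x ∂(volume.restrict (Ioo 0 L)), r x = ρ x)
    (hαa : ∀ᵐ x ∂(volume.restrict (Ioo 0 L)), α x = (a x)⁻¹)
    (hk : IsKernel k) {t : ℝ} (ht : 0 ≤ t) {x : ℝ} (hx : x ∈ Icc 0 L) :
    mollFlux L T r ψ k x t = ∫ z in (0 : ℝ)..x, r z * mollValue L T r α ψ h k z t := by
  obtain ⟨c, hc⟩ := hsol.exists_pairing_eq hL hr hr₁ hα hα₁ hrρ hαa (hk.contDiff_sub t)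
    (hk.tsupport_sub ht)
  have hcont : Continuous fun x => ∫ z in (0 : ℝ)..x,
      α z * pairingFlux L T r ψ (deriv (deriv fun τ => k (τ - t))) z := by
    rw [deriv_deriv_comp_sub]
    exact intervalIntegral.continuous_primitive (fun c d => intervalIntegrable_mul_continuous hα hα₁
      (continuous_mollFlux hψ hr hr₁ hk.deriv.deriv t) c d) 0
  -- The constant of integration is the average of the trace `h`, so the pairing agrees a.e. with
  -- `mollValue`.
  have hcc := htr.const_eq hL hψ (hk.continuous_sub t) hcont (by simp) hc
  rw [deriv_deriv_comp_sub] at hc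
  rw [mollFlux, pairingFlux, ← setIntegral_Ioo_eq_intervalIntegral hx.1,
    ← setIntegral_Ioo_eq_intervalIntegral hx.1]
  apply integral_congr_ae
  filter_upwards [ae_restrict_of_ae_restrict_of_subset (Ioo_subset_Ioo_right hx.2) hc] with z hz
  rw [hz, hcc]
  rfl

end

/-! ### The sidewise first order system and its increments in `x`. -/

section

/-- First order expansion of `∫ c F` over a short interval. -/
theorem abs_integral_mul_sub_le {c F : ℝ → ℝ} {c₁ M δ x y : ℝ} (hxy : x ≤ y)
    (hc : Measurable c) (hc₁ : ∀ z, |c z| ≤ c₁) (hFc : ContinuousOn F (Icc x y))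
    (hFM : |F x| ≤ M) (hF : ∀ z ∈ Icc x y, |F z - F x| ≤ M * (z - x))
    (hδ : ∀ᵐ z ∂(volume.restrict (Ioo x y)), |c z - c x| ≤ δ) :
    |(∫ z in x..y, c z * F z) - (y - x) * (c x * F x)| ≤ (y - x) * (c₁ * M * (y - x) + M * δ) := by
  have hFi : IntervalIntegrable F volume x y := by
    apply ContinuousOn.intervalIntegrable; rwa [uIcc_of_le hxy]
  have hi : IntervalIntegrable (fun z => c z * F z) volume x y :=
    ⟨hFi.1.bdd_mul hc.aestronglyMeasurable (Eventually.of_forall hc₁),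
      hFi.2.bdd_mul hc.aestronglyMeasurable (Eventually.of_forall hc₁)⟩
  have e : (∫ z in x..y, c z * F z) - (y - x) * (c x * F x)
      = ∫ z in x..y, (c z * F z - c x * F x) := by
    rw [intervalIntegral.integral_sub hi (by simp), intervalIntegral.integral_const, smul_eq_mul]
  have hM : 0 ≤ M := (abs_nonneg _).trans hFM
  have hc0 : 0 ≤ c₁ := (abs_nonneg _).trans (hc₁ x)
  rw [e, ← Real.norm_eq_abs, mul_comm (y - x)]
  have := intervalIntegral.norm_integral_le_of_norm_le_const_ae (a := x) (b := y)
    (f := fun z => c z * F z - c x * F x) (C := c₁ * M * (y - x) + M * δ) (by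
      rw [ae_restrict_iff' measurableSet_Ioo] at hδ
      have hne : ∀ᵐ z : ℝ, z ≠ y := by simp [ae_iff]
      filter_upwards [hδ, hne] with z hz hzy hzI
      rw [uIoc_of_le hxy] at hzI
      have h1 := hz ⟨hzI.1, lt_of_le_of_ne hzI.2 hzy⟩
      have h2 := hF z (Ioc_subset_Icc_self hzI)
      have e2 : c z * F z - c x * F x = c z * (F z - F x) + (c z - c x) * F x := by ring
      rw [e2]
      refine (norm_add_le _ _).trans (add_le_add ?_ ?_)
      · rw [norm_mul, mul_assoc]
        exact mul_le_mul (hc₁ z) (h2.trans (mul_le_mul_of_nonneg_left (by linarith [hzI.2]) hM))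
          (norm_nonneg _) hc0
      · rw [norm_mul, mul_comm]
        exact mul_le_mul hFM h1 (norm_nonneg _) hM)
  rwa [abs_of_nonneg (sub_nonneg.2 hxy)] at this

theorem sq_le_sq_add_of_abs_sub_le {u v M d : ℝ} (hu : |u| ≤ M) (hv : |v| ≤ M)
    (h : |u - v| ≤ d) : u ^ 2 ≤ v ^ 2 + 2 * M * d := by
  have h1 : |u + v| ≤ 2 * M := (abs_add_le _ _).trans (by linarith)
  have h2 : |(u - v) * (u + v)| ≤ d * (2 * M) := by
    rw [abs_mul]
    exact mul_le_mul h h1 (abs_nonneg _) ((abs_nonneg _).trans h)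
  nlinarith [le_abs_self ((u - v) * (u + v))]

/-- First order expansion of a square. -/
theorem sq_le_sq_add_two_mul {p q a d M e : ℝ} (hp : |p| ≤ M) (hqp : |q - p| ≤ d)
    (hlin : |q - p - a| ≤ e) : q ^ 2 ≤ p ^ 2 + 2 * p * a + 2 * M * e + d ^ 2 := by
  have h1 : |p * (q - p - a)| ≤ M * e := by
    rw [abs_mul]
    exact mul_le_mul hp hlin (abs_nonneg _) ((abs_nonneg _).trans hp)
  have h2 : (q - p) ^ 2 ≤ d ^ 2 := by
    rw [← sq_abs]
    exact pow_le_pow_left₀ (abs_nonneg _) hqp 2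
  nlinarith [le_abs_self (p * (q - p - a))]

/-- A regular solution of the first order system `P_x = α Q_t`, `Q_x = r P_t` on
`(0, L) × (0, ∞)`, vanishing at the time `T`. -/
structure IsSidewiseSolution (L T : ℝ) (r α : ℝ → ℝ) (P Q Pt Qt : ℝ → ℝ → ℝ) (M : ℝ) : Prop where
  hasDerivAt_fst : ∀ x ∈ Icc 0 L, ∀ t, HasDerivAt (P x) (Pt x t) t
  hasDerivAt_snd : ∀ x ∈ Icc 0 L, ∀ t, HasDerivAt (Q x) (Qt x t) t
  continuous_fst : ∀ x ∈ Icc 0 L, Continuous (Pt x)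
  continuous_snd : ∀ x ∈ Icc 0 L, Continuous (Qt x)
  bound_fst : ∀ x ∈ Icc 0 L, ∀ t, |P x t| ≤ M
  bound_snd : ∀ x ∈ Icc 0 L, ∀ t, |Q x t| ≤ M
  bound_deriv_fst : ∀ x ∈ Icc 0 L, ∀ t, |Pt x t| ≤ M
  bound_deriv_snd : ∀ x ∈ Icc 0 L, ∀ t, |Qt x t| ≤ M
  lip_deriv_fst : ∀ t, 0 ≤ t → ∀ x ∈ Icc 0 L, ∀ y ∈ Icc 0 L, |Pt y t - Pt x t| ≤ M * |y - x|
  lip_deriv_snd : ∀ t, 0 ≤ t → ∀ x ∈ Icc 0 L, ∀ y ∈ Icc 0 L, |Qt y t - Qt x t| ≤ M * |y - x|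
  sub_fst : ∀ t, 0 ≤ t → ∀ x ∈ Icc 0 L, ∀ y ∈ Icc 0 L, P y t - P x t = ∫ z in x..y, α z * Qt z t
  sub_snd : ∀ t, 0 ≤ t → ∀ x ∈ Icc 0 L, ∀ y ∈ Icc 0 L, Q y t - Q x t = ∫ z in x..y, r z * Pt z t
  fst_right : ∀ x ∈ Icc 0 L, P x T = 0

/-- Coefficients of bounded variation: the relative increments are dominated, on a set `G` of full
measure, by those of the bounded monotone function `V`. -/
structure IsBVCoeff (L β r₀ r₁ α₀ α₁ B : ℝ) (r α V : ℝ → ℝ) (G : Set ℝ) : Prop where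
  r₀_pos : 0 < r₀
  α₀_pos : 0 < α₀
  measurable_r : Measurable r
  measurable_α : Measurable α
  r_mem : ∀ x, r₀ ≤ r x ∧ r x ≤ r₁
  α_mem : ∀ x, α₀ ≤ α x ∧ α x ≤ α₁
  G_subset : G ⊆ Ioo 0 L
  ae_mem : ∀ᵐ x ∂(volume.restrict (Ioo 0 L)), x ∈ G
  V_mem : ∀ x, 0 ≤ V x ∧ V x ≤ B
  speed : ∀ x ∈ G, √(r x * α x) ≤ β
  variation : ∀ x ∈ G, ∀ y ∈ G, x ≤ y →
    |r y - r x| ≤ r₀ * (V y - V x) ∧ |α y - α x| ≤ α₀ * (V y - V x)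

variable {L T β r₀ r₁ α₀ α₁ B M : ℝ} {r α V : ℝ → ℝ} {G : Set ℝ} {P Q Pt Qt : ℝ → ℝ → ℝ}

theorem IsBVCoeff.abs_r_le (hc : IsBVCoeff L β r₀ r₁ α₀ α₁ B r α V G) (x : ℝ) : |r x| ≤ r₁ := by
  rw [abs_of_pos (hc.r₀_pos.trans_le (hc.r_mem x).1)]; exact (hc.r_mem x).2

theorem IsBVCoeff.abs_α_le (hc : IsBVCoeff L β r₀ r₁ α₀ α₁ B r α V G) (x : ℝ) : |α x| ≤ α₁ := by
  rw [abs_of_pos (hc.α₀_pos.trans_le (hc.α_mem x).1)]; exact (hc.α_mem x).2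

theorem IsBVCoeff.V_mono (hc : IsBVCoeff L β r₀ r₁ α₀ α₁ B r α V G) {x y : ℝ} (hx : x ∈ G)
    (hy : y ∈ G) (hxy : x ≤ y) : V x ≤ V y := by
  have := (abs_nonneg _).trans (hc.variation x hx y hy hxy).1
  linarith [nonneg_of_mul_nonneg_right this hc.r₀_pos]

/-- The sidewise energy on the characteristic cone. -/
noncomputable def sidewiseEnergy (T β : ℝ) (r α V : ℝ → ℝ) (P Q : ℝ → ℝ → ℝ) (x : ℝ) : ℝ :=
  ∫ t in x * β..T, Real.exp (-V x) * (r x * P x t ^ 2 + α x * Q x t ^ 2)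

/-- Because `c ≥ c₀`, the hypothesis gives `c' ≤ c (1 + (V' - V)) ≤ c exp (V' - V)`. The exponential
weight thus absorbs all growth of a BV coefficient, jumps included. -/
theorem exp_neg_mul_le {c₀ c c' V V' : ℝ} (hc₀ : c₀ ≤ c) (hV : V ≤ V')
    (h : |c' - c| ≤ c₀ * (V' - V)) : Real.exp (-V') * c' ≤ Real.exp (-V) * c := by
  have h1 : c' ≤ c * (1 + (V' - V)) := by
    have := (le_abs_self _).trans h
    nlinarith [mul_le_mul_of_nonneg_right hc₀ (sub_nonneg.2 hV)]
  have hc' : 0 ≤ c₀ * (V' - V) := (abs_nonneg _).trans h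
  have e : Real.exp (-V) * c = Real.exp (-V') * (Real.exp (V' - V) * c) := by
    rw [← mul_assoc, ← Real.exp_add]; congr 2; ring
  rw [e]
  refine mul_le_mul_of_nonneg_left ?_ (Real.exp_pos _).le
  -- The sign of `c` follows from `h` only when `V < V'`; for equal values `h1` already suffices.
  rcases hV.eq_or_lt with rfl | hlt
  · simpa using h1
  · have hc0 : 0 ≤ c := (nonneg_of_mul_nonneg_left hc' (sub_pos.2 hlt)).trans hc₀
    have := Real.add_one_le_exp (V' - V)
    nlinarith

namespace IsSidewiseSolution

variable (hs : IsSidewiseSolution L T r α P Q Pt Qt M) (hc : IsBVCoeff L β r₀ r₁ α₀ α₁ B r α V G)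
include hs

theorem continuous_P {x : ℝ} (hx : x ∈ Icc 0 L) : Continuous (P x) :=
  continuous_iff_continuousAt.2 fun t => (hs.hasDerivAt_fst x hx t).continuousAt

theorem continuous_Q {x : ℝ} (hx : x ∈ Icc 0 L) : Continuous (Q x) :=
  continuous_iff_continuousAt.2 fun t => (hs.hasDerivAt_snd x hx t).continuousAt

include hc

theorem abs_sub_P_le {x y t : ℝ} (ht : 0 ≤ t) (hx : x ∈ Icc 0 L) (hy : y ∈ Icc 0 L) :
    |P y t - P x t| ≤ α₁ * M * |y - x| := by
  rw [hs.sub_fst t ht x hx y hy, ← Real.norm_eq_abs]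
  refine intervalIntegral.norm_integral_le_of_norm_le_const fun z hz => ?_
  have hz' : z ∈ Icc 0 L := uIcc_subset_Icc hx hy (uIoc_subset_uIcc hz)
  rw [norm_mul]
  exact mul_le_mul (hc.abs_α_le z) (hs.bound_deriv_snd z hz' t) (norm_nonneg _)
    ((abs_nonneg _).trans (hc.abs_α_le z))

theorem abs_sub_Q_le {x y t : ℝ} (ht : 0 ≤ t) (hx : x ∈ Icc 0 L) (hy : y ∈ Icc 0 L) :
    |Q y t - Q x t| ≤ r₁ * M * |y - x| := by
  rw [hs.sub_snd t ht x hx y hy, ← Real.norm_eq_abs]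
  refine intervalIntegral.norm_integral_le_of_norm_le_const fun z hz => ?_
  have hz' : z ∈ Icc 0 L := uIcc_subset_Icc hx hy (uIoc_subset_uIcc hz)
  rw [norm_mul]
  exact mul_le_mul (hc.abs_r_le z) (hs.bound_deriv_fst z hz' t) (norm_nonneg _)
    ((abs_nonneg _).trans (hc.abs_r_le z))

/-- Freezing `α` and `Q_t` at `x` gives the linear term. The errors come from the Lipschitz bound on
`Q_t` and from the variation of `α`; both are `y - x` times an increment of `x + V x`, the form that
subdivision eliminates. -/
theorem sq_P_le {x y t : ℝ} (ht : 0 ≤ t) (hx : x ∈ G) (hy : y ∈ G) (hxy : x < y) :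
    P y t ^ 2 ≤ P x t ^ 2 + (y - x) * (2 * α x * (P x t * Qt x t))
      + (y - x) * ((2 * M * M * (α₁ + α₀) + (α₁ * M) ^ 2) * ((y - x) + (V y - V x))) := by
  have hx' := Ioo_subset_Icc_self (hc.G_subset hx)
  have hy' := Ioo_subset_Icc_self (hc.G_subset hy)
  have hsub : Icc x y ⊆ Icc 0 L := Icc_subset_Icc hx'.1 hy'.2
  have hM : 0 ≤ M := (abs_nonneg _).trans (hs.bound_fst x hx' 0)
  have hα₁ : 0 ≤ α₁ := (abs_nonneg _).trans (hc.abs_α_le 0)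
  have hα₀ := hc.α₀_pos
  have hV := hc.V_mono hx hy hxy.le
  have h1 := hs.abs_sub_P_le hc ht hx' hy'
  rw [abs_of_pos (sub_pos.2 hxy)] at h1
  have h2 := abs_integral_mul_sub_le (c := α) (F := fun z => Qt z t) (c₁ := α₁) (M := M)
    (δ := α₀ * (V y - V x)) hxy.le hc.measurable_α hc.abs_α_le (by
      refine LipschitzOnWith.continuousOn (K := M.toNNReal) (LipschitzOnWith.of_dist_le_mul
        fun u hu v hv => ?_)
      rw [Real.dist_eq, Real.dist_eq, Real.coe_toNNReal _ hM]
      exact hs.lip_deriv_snd t ht v (hsub hv) u (hsub hu))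
    (hs.bound_deriv_snd x hx' t) (fun z hz => by
      have := hs.lip_deriv_snd t ht x hx' z (hsub hz)
      rwa [abs_of_nonneg (sub_nonneg.2 hz.1)] at this) (by
      filter_upwards [ae_restrict_of_ae_restrict_of_subset
        (Ioo_subset_Ioo hx'.1 hy'.2) hc.ae_mem, ae_restrict_mem measurableSet_Ioo] with z hz hzI
      refine (hc.variation x hx z hz hzI.1.le).2.trans ?_
      exact mul_le_mul_of_nonneg_left (by linarith [hc.V_mono hz hy hzI.2.le]) hα₀.le)
  rw [← hs.sub_fst t ht x hx' y hy'] at h2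
  have h3 := sq_le_sq_add_two_mul (hs.bound_fst x hx' t) h1 h2
  have hh : 0 < y - x := sub_pos.2 hxy
  have hδ : 0 ≤ V y - V x := sub_nonneg.2 hV
  -- `k1` and `k2` are the cross terms missing from the sharper error, added to reach the common
  -- factor `(y - x) + (V y - V x)`.
  have k1 : 0 ≤ (y - x) * (2 * M * M * α₀ * (y - x)) := by positivity
  have k2 : 0 ≤ (y - x) * ((2 * M * M * α₁ + (α₁ * M) ^ 2) * (V y - V x)) := by positivity
  linarith

theorem sq_Q_le {x y t : ℝ} (ht : 0 ≤ t) (hx : x ∈ G) (hy : y ∈ G) (hxy : x < y) :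
    Q y t ^ 2 ≤ Q x t ^ 2 + (y - x) * (2 * r x * (Q x t * Pt x t))
      + (y - x) * ((2 * M * M * (r₁ + r₀) + (r₁ * M) ^ 2) * ((y - x) + (V y - V x))) := by
  have hx' := Ioo_subset_Icc_self (hc.G_subset hx)
  have hy' := Ioo_subset_Icc_self (hc.G_subset hy)
  have hsub : Icc x y ⊆ Icc 0 L := Icc_subset_Icc hx'.1 hy'.2
  have hM : 0 ≤ M := (abs_nonneg _).trans (hs.bound_fst x hx' 0)
  have hr₁ : 0 ≤ r₁ := (abs_nonneg _).trans (hc.abs_r_le 0)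
  have hr₀ := hc.r₀_pos
  have hV := hc.V_mono hx hy hxy.le
  have h1 := hs.abs_sub_Q_le hc ht hx' hy'
  rw [abs_of_pos (sub_pos.2 hxy)] at h1
  have h2 := abs_integral_mul_sub_le (c := r) (F := fun z => Pt z t) (c₁ := r₁) (M := M)
    (δ := r₀ * (V y - V x)) hxy.le hc.measurable_r hc.abs_r_le (by
      refine LipschitzOnWith.continuousOn (K := M.toNNReal) (LipschitzOnWith.of_dist_le_mul
        fun u hu v hv => ?_)
      rw [Real.dist_eq, Real.dist_eq, Real.coe_toNNReal _ hM]
      exact hs.lip_deriv_fst t ht v (hsub hv) u (hsub hu))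
    (hs.bound_deriv_fst x hx' t) (fun z hz => by
      have := hs.lip_deriv_fst t ht x hx' z (hsub hz)
      rwa [abs_of_nonneg (sub_nonneg.2 hz.1)] at this) (by
      filter_upwards [ae_restrict_of_ae_restrict_of_subset
        (Ioo_subset_Ioo hx'.1 hy'.2) hc.ae_mem, ae_restrict_mem measurableSet_Ioo] with z hz hzI
      refine (hc.variation x hx z hz hzI.1.le).1.trans ?_
      exact mul_le_mul_of_nonneg_left (by linarith [hc.V_mono hz hy hzI.2.le]) hr₀.le)
  rw [← hs.sub_snd t ht x hx' y hy'] at h2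
  have h3 := sq_le_sq_add_two_mul (hs.bound_snd x hx' t) h1 h2
  have hh : 0 < y - x := sub_pos.2 hxy
  have hδ : 0 ≤ V y - V x := sub_nonneg.2 hV
  have k1 : 0 ≤ (y - x) * (2 * M * M * r₀ * (y - x)) := by positivity
  have k2 : 0 ≤ (y - x) * ((2 * M * M * r₁ + (r₁ * M) ^ 2) * (V y - V x)) := by positivity
  linarith

end IsSidewiseSolution

end

/-! ### Monotonicity of the sidewise energy. -/

section

variable {L T β r₀ r₁ α₀ α₁ B M : ℝ} {r α V : ℝ → ℝ} {G : Set ℝ} {P Q Pt Qt : ℝ → ℝ → ℝ}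

namespace IsSidewiseSolution

variable (hs : IsSidewiseSolution L T r α P Q Pt Qt M) (hc : IsBVCoeff L β r₀ r₁ α₀ α₁ B r α V G)
include hs

theorem continuous_density {x : ℝ} (hx : x ∈ Icc 0 L) (w c d : ℝ) :
    Continuous fun t => w * (c * P x t ^ 2 + d * Q x t ^ 2) := by
  have := hs.continuous_P hx
  have := hs.continuous_Q hx
  fun_prop

/-- The integrand is `(P Q)_t` and `P` vanishes at `T`, so only the foot of the cone contributes; no
final condition on `Q` is needed. -/
theorem integral_deriv_mul {x : ℝ} (hx : x ∈ Icc 0 L) (t₀ : ℝ) :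
    ∫ t in t₀..T, (P x t * Qt x t + Q x t * Pt x t) = -(P x t₀ * Q x t₀) := by
  have h := intervalIntegral.integral_eq_sub_of_hasDerivAt (a := t₀) (b := T)
    (f := fun t => P x t * Q x t) (f' := fun t => P x t * Qt x t + Q x t * Pt x t)
    (fun t _ => by
      convert! (hs.hasDerivAt_fst x hx t).mul (hs.hasDerivAt_snd x hx t) using 1
      ring)
    (Continuous.intervalIntegrable (by
      have := hs.continuous_P hx; have := hs.continuous_Q hx
      have := hs.continuous_fst x hx; have := hs.continuous_snd x hx
      fun_prop) _ _)
  rw [h, hs.fst_right x hx]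
  ring

include hc

/-- The energy on a short characteristic strip bounds the boundary flux of the energy. -/
theorem strip_le {x y : ℝ} (hx : x ∈ G) (hxy : x ≤ y) :
    2 * (y - x) * Real.exp (-V x) * (r x * α x) * -(P x (y * β) * Q x (y * β))
      ≤ (∫ t in x * β..y * β, Real.exp (-V x) * (r x * P x t ^ 2 + α x * Q x t ^ 2))
        + 2 * (r₁ + α₁) * M ^ 2 * β ^ 2 * (y - x) ^ 2 := by
  have hx' := Ioo_subset_Icc_self (hc.G_subset hx)
  have hβ : 0 ≤ β := (Real.sqrt_nonneg _).trans (hc.speed x hx)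
  have hr := hc.r_mem x
  have hα := hc.α_mem x
  have hr0 := hc.r₀_pos
  have hα0 := hc.α₀_pos
  have hrx : 0 < r x := by linarith
  have hαx : 0 < α x := by linarith
  have hw : 0 < Real.exp (-V x) := Real.exp_pos _
  have hw1 : Real.exp (-V x) ≤ 1 := Real.exp_le_one_iff.2 (by linarith [(hc.V_mem x).1])
  have hM : 0 ≤ M := (abs_nonneg _).trans (hs.bound_fst x hx' 0)
  set t₁ := y * β with ht₁
  have hle : x * β ≤ t₁ := mul_le_mul_of_nonneg_right hxy hβ
  set D := 2 * (r₁ + α₁) * M ^ 2 with hD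
  set e : ℝ → ℝ := fun t => Real.exp (-V x) * (r x * P x t ^ 2 + α x * Q x t ^ 2) with he
  -- The density is `D`-Lipschitz in time, so on the strip it stays within `D (y - x) β` of its
  -- value at the upper end.
  have hlow : ∀ t ∈ Icc (x * β) t₁, e t₁ - D * ((y - x) * β) ≤ e t := by
    intro t ht
    have hd : ∀ u, HasDerivAt e (Real.exp (-V x) * (r x * (2 * P x u * Pt x u)
        + α x * (2 * Q x u * Qt x u))) u := fun u => by
      have h1 := ((hs.hasDerivAt_fst x hx' u).pow 2).const_mul (r x)
      have h2 := ((hs.hasDerivAt_snd x hx' u).pow 2).const_mul (α x)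
      convert! (h1.add h2).const_mul (Real.exp (-V x)) using 1
      push_cast; ring
    have hmul : ∀ p q : ℝ, |p| ≤ M → |q| ≤ M → |2 * p * q| ≤ 2 * M ^ 2 := fun p q hp hq => by
      rw [mul_assoc, abs_mul, abs_mul, abs_two, sq]
      exact mul_le_mul_of_nonneg_left (mul_le_mul hp hq (abs_nonneg _) hM) zero_le_two
    have hb : ∀ u, ‖Real.exp (-V x) * (r x * (2 * P x u * Pt x u)
        + α x * (2 * Q x u * Qt x u))‖ ≤ D := fun u => by
      have b1 := hmul _ _ (hs.bound_fst x hx' u) (hs.bound_deriv_fst x hx' u)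
      have b2 := hmul _ _ (hs.bound_snd x hx' u) (hs.bound_deriv_snd x hx' u)
      rw [Real.norm_eq_abs, abs_mul, abs_of_pos hw]
      have b3 : |r x * (2 * P x u * Pt x u) + α x * (2 * Q x u * Qt x u)| ≤ D := by
        refine (abs_add_le _ _).trans ?_
        rw [abs_mul (r x), abs_mul (α x), abs_of_pos hrx, abs_of_pos hαx]
        have c1 := mul_le_mul hr.2 b1 (abs_nonneg _) (by linarith)
        have c2 := mul_le_mul hα.2 b2 (abs_nonneg _) (by linarith)
        rw [hD]; linarith
      calc _ ≤ 1 * D := mul_le_mul hw1 b3 (abs_nonneg _) zero_le_one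
        _ = D := one_mul _
    have := convex_univ.norm_image_sub_le_of_norm_hasDerivWithin_le (f := e) (x := t) (y := t₁)
      (fun u _ => (hd u).hasDerivWithinAt) (fun u _ => hb u) (mem_univ _) (mem_univ _)
    rw [Real.norm_eq_abs, Real.norm_eq_abs, abs_of_nonneg (sub_nonneg.2 ht.2)] at this
    have h2 := (le_abs_self _).trans this
    have hD0 : 0 ≤ D := by
      have : 0 < r₁ + α₁ := by linarith
      positivity
    have h3 : D * (t₁ - t) ≤ D * ((y - x) * β) :=
      mul_le_mul_of_nonneg_left (by rw [ht₁]; linarith [ht.1]) hD0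
    linarith
  have hint : (y - x) * β * (e t₁ - D * ((y - x) * β)) ≤ ∫ t in x * β..t₁, e t := by
    have := intervalIntegral.integral_mono_on hle (intervalIntegrable_const (μ := volume)
      (c := e t₁ - D * ((y - x) * β)))
      ((hs.continuous_density hx' _ _ _).intervalIntegrable (x * β) t₁) hlow
    rw [intervalIntegral.integral_const, smul_eq_mul] at this
    calc _ = (t₁ - x * β) * (e t₁ - D * ((y - x) * β)) := by rw [ht₁]; ring
      _ ≤ _ := this
  -- The slope of the cone enters here: with `σ = √(r α) ≤ β`, the square `(√r P + √α Q)² ≥ 0`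
  -- bounds `-2 σ P Q` by the density, and one more factor `σ` is bounded by `β`.
  have hpq : 2 * (r x * α x) * -(P x t₁ * Q x t₁) ≤ β * (r x * P x t₁ ^ 2 + α x * Q x t₁ ^ 2) := by
    set σ := √(r x * α x) with hσ
    have hσ2 : σ ^ 2 = r x * α x := Real.sq_sqrt (by positivity)
    have hσ0 : 0 ≤ σ := Real.sqrt_nonneg _
    have h1 : 2 * σ * -(P x t₁ * Q x t₁) ≤ r x * P x t₁ ^ 2 + α x * Q x t₁ ^ 2 := by
      have h3 : σ = √(r x) * √(α x) := Real.sqrt_mul hrx.le _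
      have h4 := Real.sq_sqrt hrx.le
      have h5 := Real.sq_sqrt hαx.le
      have h6 := sq_nonneg (√(r x) * P x t₁ + √(α x) * Q x t₁)
      rw [h3]
      nlinarith
    have h2 : 0 ≤ r x * P x t₁ ^ 2 + α x * Q x t₁ ^ 2 := by positivity
    calc _ = σ * (2 * σ * -(P x t₁ * Q x t₁)) := by rw [← hσ2]; ring
      _ ≤ σ * (r x * P x t₁ ^ 2 + α x * Q x t₁ ^ 2) := mul_le_mul_of_nonneg_left h1 hσ0
      _ ≤ _ := mul_le_mul_of_nonneg_right (hc.speed x hx) h2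
  have hfin := mul_le_mul_of_nonneg_left hpq (mul_nonneg (sub_nonneg.2 hxy) hw.le)
  simp only [he] at hint ⊢
  linarith

/-- Almost monotonicity of the sidewise energy over short intervals. -/
theorem sidewiseEnergy_sub_le (hT : L * β < T) : ∃ K, 0 ≤ K ∧ ∀ x ∈ G, ∀ y ∈ G, x < y →
    sidewiseEnergy T β r α V P Q y - sidewiseEnergy T β r α V P Q x
      ≤ (y - x) * (K * (y + V y) - K * (x + V x)) := by
  by_cases hGe : G = ∅
  · exact ⟨0, le_rfl, by simp [hGe]⟩
  obtain ⟨x₀, hx₀⟩ := nonempty_iff_ne_empty.2 hGe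
  have hβ : 0 ≤ β := (Real.sqrt_nonneg _).trans (hc.speed x₀ hx₀)
  have hL : 0 < L := (hc.G_subset hx₀).1.trans (hc.G_subset hx₀).2
  have hT0 : 0 ≤ T := (mul_nonneg hL.le hβ).trans hT.le
  have hM : 0 ≤ M := (abs_nonneg _).trans (hs.bound_fst 0 ⟨le_rfl, hL.le⟩ 0)
  have hr₀ := hc.r₀_pos
  have hα₀ := hc.α₀_pos
  have hr₁ : 0 ≤ r₁ := (abs_nonneg _).trans (hc.abs_r_le 0)
  have hα₁ : 0 ≤ α₁ := (abs_nonneg _).trans (hc.abs_α_le 0)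
  set c₁ := 2 * M * M * (α₁ + α₀) + (α₁ * M) ^ 2 with hc₁
  set c₂ := 2 * M * M * (r₁ + r₀) + (r₁ * M) ^ 2 with hc₂
  set D := 2 * (r₁ + α₁) * M ^ 2 * β ^ 2 with hD
  have hc₁0 : 0 ≤ c₁ := by positivity
  have hc₂0 : 0 ≤ c₂ := by positivity
  have hD0 : 0 ≤ D := by positivity
  set c₃ := r₁ * c₁ + α₁ * c₂ with hc₃
  have hc₃0 : 0 ≤ c₃ := by positivity
  -- `T * c₃` collects the expansion errors integrated over a time interval of length at most `T`;
  -- `D` is the error on the strip.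
  refine ⟨T * c₃ + D, by positivity, fun x hx y hy hxy => ?_⟩
  have hx' := Ioo_subset_Icc_self (hc.G_subset hx)
  have hy' := Ioo_subset_Icc_self (hc.G_subset hy)
  have hh : 0 < y - x := sub_pos.2 hxy
  have hδ : 0 ≤ V y - V x := sub_nonneg.2 (hc.V_mono hx hy hxy.le)
  have hrx : 0 < r x := hr₀.trans_le (hc.r_mem x).1
  have hαx : 0 < α x := hα₀.trans_le (hc.α_mem x).1
  have hw : 0 < Real.exp (-V x) := Real.exp_pos _
  have hw1 : Real.exp (-V x) ≤ 1 := Real.exp_le_one_iff.2 (by linarith [(hc.V_mem x).1])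
  have hyT : y * β ≤ T := (mul_le_mul_of_nonneg_right hy'.2 hβ).trans hT.le
  have hyβ : 0 ≤ y * β := mul_nonneg hy'.1 hβ
  set ε := (y - x) * ((y - x) + (V y - V x)) with hε
  have hε0 : 0 ≤ ε := by positivity
  have hvar := hc.variation x hx y hy hxy.le
  have w1 := exp_neg_mul_le (hc.r_mem x).1 (hc.V_mono hx hy hxy.le) hvar.1
  have w2 := exp_neg_mul_le (hc.α_mem x).1 (hc.V_mono hx hy hxy.le) hvar.2
  -- After the weights have been compared, the linear terms of the two expansions combine into a
  -- multiple of `(P Q)_t`, thanks to the common factor `2 r α`.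
  have hpt : ∀ t ∈ Icc (y * β) T,
      Real.exp (-V y) * (r y * P y t ^ 2 + α y * Q y t ^ 2)
        ≤ Real.exp (-V x) * (r x * P x t ^ 2 + α x * Q x t ^ 2)
          + 2 * (y - x) * Real.exp (-V x) * (r x * α x) * (P x t * Qt x t + Q x t * Pt x t)
          + c₃ * ε := by
    intro t ht
    have ht0 : 0 ≤ t := hyβ.trans ht.1
    have s1 := hs.sq_P_le hc ht0 hx hy hxy
    have s2 := hs.sq_Q_le hc ht0 hx hy hxy
    rw [← hc₁] at s1
    rw [← hc₂] at s2
    have u1 := mul_le_mul_of_nonneg_right w1 (sq_nonneg (P y t))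
    have u2 := mul_le_mul_of_nonneg_right w2 (sq_nonneg (Q y t))
    have v1 := mul_le_mul_of_nonneg_left s1 (mul_pos hw hrx).le
    have v2 := mul_le_mul_of_nonneg_left s2 (mul_pos hw hαx).le
    have z1 : Real.exp (-V x) * r x * (c₁ * ε) ≤ 1 * r₁ * (c₁ * ε) :=
      mul_le_mul_of_nonneg_right (mul_le_mul hw1 (hc.r_mem x).2 hrx.le zero_le_one) (by positivity)
    have z2 : Real.exp (-V x) * α x * (c₂ * ε) ≤ 1 * α₁ * (c₂ * ε) :=
      mul_le_mul_of_nonneg_right (mul_le_mul hw1 (hc.α_mem x).2 hαx.le zero_le_one) (by positivity)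
    rw [hε] at z1 z2 ⊢
    rw [hc₃]
    linarith
  have hcd : Continuous fun t => P x t * Qt x t + Q x t * Pt x t := by
    have := hs.continuous_P hx'; have := hs.continuous_Q hx'
    have := hs.continuous_fst x hx'; have := hs.continuous_snd x hx'
    fun_prop
  have hint : ∫ t in y * β..T, Real.exp (-V y) * (r y * P y t ^ 2 + α y * Q y t ^ 2)
      ≤ ∫ t in y * β..T, (Real.exp (-V x) * (r x * P x t ^ 2 + α x * Q x t ^ 2)
          + 2 * (y - x) * Real.exp (-V x) * (r x * α x) * (P x t * Qt x t + Q x t * Pt x t)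
          + c₃ * ε) :=
    intervalIntegral.integral_mono_on hyT
      ((hs.continuous_density hy' _ _ _).intervalIntegrable _ _)
      ((((hs.continuous_density hx' _ _ _).add (hcd.const_mul _)).add
        continuous_const).intervalIntegrable _ _) hpt
  have hsum : IntervalIntegrable (fun t => Real.exp (-V x) * (r x * P x t ^ 2 + α x * Q x t ^ 2)
      + 2 * (y - x) * Real.exp (-V x) * (r x * α x) * (P x t * Qt x t + Q x t * Pt x t))
      volume (y * β) T :=
    ((hs.continuous_density hx' _ _ _).add (hcd.const_mul _)).intervalIntegrable _ _
  rw [intervalIntegral.integral_add hsum intervalIntegrable_const,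
    intervalIntegral.integral_add ((hs.continuous_density hx' _ _ _).intervalIntegrable _ _)
      ((hcd.const_mul _).intervalIntegrable _ _),
    intervalIntegral.integral_const_mul (2 * (y - x) * Real.exp (-V x) * (r x * α x)),
    hs.integral_deriv_mul hx', intervalIntegral.integral_const, smul_eq_mul] at hint
  -- Passing from `x` to `y` the energy loses the strip `(xβ, yβ)`, and this loss pays for the
  -- boundary term at `t = yβ`.
  have hsplit := intervalIntegral.integral_add_adjacent_intervals (μ := volume)
    ((hs.continuous_density hx' (Real.exp (-V x)) (r x) (α x)).intervalIntegrable (x * β) (y * β))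
    ((hs.continuous_density hx' (Real.exp (-V x)) (r x) (α x)).intervalIntegrable (y * β) T)
  have hstrip := hs.strip_le hc hx hxy.le
  have hTe : (T - y * β) * (c₃ * ε) ≤ T * (c₃ * ε) :=
    mul_le_mul_of_nonneg_right (by linarith) (by positivity)
  have hDe : D * (y - x) ^ 2 ≤ D * ε := by
    refine mul_le_mul_of_nonneg_left ?_ hD0
    rw [hε, sq]
    exact mul_le_mul_of_nonneg_left (by linarith) hh.le
  simp only [sidewiseEnergy]
  have hgoal : (y - x) * ((T * c₃ + D) * (y + V y) - (T * c₃ + D) * (x + V x))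
      = T * (c₃ * ε) + D * ε := by rw [hε]; ring
  rw [hgoal, ← hsplit]
  linarith

/-- The increments of `x + V x` telescope under subdivision while the mesh tends to zero, so the
error in the almost monotonicity disappears even where `V` jumps. -/
theorem sidewiseEnergy_anti (hT : L * β < T) {x y : ℝ} (hx : x ∈ G) (hy : y ∈ G) (hxy : x < y) :
    sidewiseEnergy T β r α V P Q y ≤ sidewiseEnergy T β r α V P Q x := by
  obtain ⟨K, hK, h⟩ := hs.sidewiseEnergy_sub_le hc hT
  refine le_of_increment_le (W := fun x => K * (x + V x)) (fun u v h0 huv hv => ?_) hc.G_subset h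
    (fun u hu v hv huv => ?_) hx hy hxy
  · obtain ⟨z, hz, hzG⟩ := exists_of_ae_restrict_Ioo huv
      (ae_restrict_of_ae_restrict_of_subset (Ioo_subset_Ioo h0.le hv.le) hc.ae_mem)
    exact ⟨z, hzG, hz⟩
  · exact mul_le_mul_of_nonneg_left (by linarith [hc.V_mono hu hv huv.le]) hK

/-- The sidewise energy estimate. -/
theorem integral_sq_le (hL : 0 < L) (hT : L * β < T) (hQ0 : ∀ t, Q 0 t = 0) :
    ∫ t in L * β..T, Q L t ^ 2 ≤ Real.exp B * r₁ / α₀ * ∫ t in (0 : ℝ)..T, P 0 t ^ 2 := by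
  obtain ⟨x₀, -, hx₀⟩ := exists_of_ae_restrict_Ioo hL hc.ae_mem
  have hβ : 0 ≤ β := (Real.sqrt_nonneg _).trans (hc.speed x₀ hx₀)
  have hLβ : 0 ≤ L * β := mul_nonneg hL.le hβ
  have hT0 : 0 ≤ T := hLβ.trans hT.le
  have h0 : (0 : ℝ) ∈ Icc 0 L := ⟨le_rfl, hL.le⟩
  have hL' : L ∈ Icc 0 L := ⟨hL.le, le_rfl⟩
  have hM : 0 ≤ M := (abs_nonneg _).trans (hs.bound_fst 0 h0 0)
  have hr₀ := hc.r₀_pos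
  have hα₀ := hc.α₀_pos
  have hr₁ : 0 ≤ r₁ := (abs_nonneg _).trans (hc.abs_r_le 0)
  have hα₁ : 0 ≤ α₁ := (abs_nonneg _).trans (hc.abs_α_le 0)
  have eP : ∀ x ∈ Icc 0 L, Continuous fun t => P x t ^ 2 := fun x hx => (hs.continuous_P hx).pow 2
  have eQ : ∀ x ∈ Icc 0 L, Continuous fun t => Q x t ^ 2 := fun x hx => (hs.continuous_Q hx).pow 2
  set K₁ := T * (r₁ * (2 * M * (α₁ * M)) + α₁ * (2 * M * (r₁ * M))) with hK₁
  set c := Real.exp (-B) * α₀ with hcdef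
  have hcpos : 0 < c := by positivity
  set K₂ := c * (T * (2 * M * (r₁ * M))) with hK₂
  have hK₁0 : 0 ≤ K₁ := by positivity
  have hK₂0 : 0 ≤ K₂ := by positivity
  -- The set `G` omits the endpoints, so the energy is compared near `0` and near `L` with the
  -- boundary data, at a cost linear in the distance. Near `0` only `P` remains, since `Q 0 = 0`.
  have up : ∀ x ∈ G, sidewiseEnergy T β r α V P Q x
      ≤ r₁ * (∫ t in (0 : ℝ)..T, P 0 t ^ 2) + K₁ * x := by
    intro x hx
    have hx' := Ioo_subset_Icc_self (hc.G_subset hx)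
    have hrx : 0 < r x := hr₀.trans_le (hc.r_mem x).1
    have hαx : 0 < α x := hα₀.trans_le (hc.α_mem x).1
    have hw1 : Real.exp (-V x) ≤ 1 := Real.exp_le_one_iff.2 (by linarith [(hc.V_mem x).1])
    have hxT : x * β ≤ T := (mul_le_mul_of_nonneg_right hx'.2 hβ).trans hT.le
    have s1 : sidewiseEnergy T β r α V P Q x
        ≤ ∫ t in (0 : ℝ)..T, Real.exp (-V x) * (r x * P x t ^ 2 + α x * Q x t ^ 2) := by
      refine intervalIntegral.integral_mono_interval (mul_nonneg hx'.1 hβ) hxT le_rfl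
        (Eventually.of_forall fun t => ?_) ((hs.continuous_density hx' _ _ _).intervalIntegrable _ _)
      change 0 ≤ Real.exp (-V x) * (r x * P x t ^ 2 + α x * Q x t ^ 2)
      positivity
    refine s1.trans ?_
    have s2 : ∫ t in (0 : ℝ)..T, Real.exp (-V x) * (r x * P x t ^ 2 + α x * Q x t ^ 2)
        ≤ ∫ t in (0 : ℝ)..T, (r₁ * P 0 t ^ 2
          + (r₁ * (2 * M * (α₁ * M)) + α₁ * (2 * M * (r₁ * M))) * x) :=
      intervalIntegral.integral_mono_on hT0
      ((hs.continuous_density hx' (Real.exp (-V x)) (r x) (α x)).intervalIntegrable _ _)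
      ((((eP 0 h0).const_mul r₁).add continuous_const).intervalIntegrable (μ := volume) 0 T) (fun t ht => by
        have a1 := hs.abs_sub_P_le hc ht.1 h0 hx'
        have a2 := hs.abs_sub_Q_le hc ht.1 h0 hx'
        rw [sub_zero, abs_of_nonneg hx'.1] at a1 a2
        have b1 := sq_le_sq_add_of_abs_sub_le (hs.bound_fst x hx' t) (hs.bound_fst 0 h0 t) a1
        have b2 := sq_le_sq_add_of_abs_sub_le (hs.bound_snd x hx' t) (hs.bound_snd 0 h0 t) a2
        rw [hQ0] at b2
        have d1 := mul_le_mul (hc.r_mem x).2 b1 (sq_nonneg _) hr₁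
        have d2 := mul_le_mul (hc.α_mem x).2 b2 (sq_nonneg _) hα₁
        have d3 := mul_le_mul_of_nonneg_right hw1
          (by positivity : 0 ≤ r x * P x t ^ 2 + α x * Q x t ^ 2)
        linarith)
    refine s2.trans (le_of_eq ?_)
    rw [intervalIntegral.integral_add (((eP 0 h0).const_mul r₁).intervalIntegrable _ _)
        intervalIntegrable_const,
      intervalIntegral.integral_const_mul, intervalIntegral.integral_const, smul_eq_mul, hK₁]
    ring
  have low : ∀ y ∈ G, c * (∫ t in L * β..T, Q L t ^ 2)
      ≤ sidewiseEnergy T β r α V P Q y + K₂ * (L - y) := by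
    intro y hy
    have hy' := Ioo_subset_Icc_self (hc.G_subset hy)
    have hry : 0 < r y := hr₀.trans_le (hc.r_mem y).1
    have hαy : 0 < α y := hα₀.trans_le (hc.α_mem y).1
    have hyL : y * β ≤ L * β := mul_le_mul_of_nonneg_right hy'.2 hβ
    have s1 : ∫ t in L * β..T, Real.exp (-V y) * (r y * P y t ^ 2 + α y * Q y t ^ 2)
        ≤ sidewiseEnergy T β r α V P Q y := by
      refine intervalIntegral.integral_mono_interval hyL hT.le le_rfl
        (Eventually.of_forall fun t => ?_) ((hs.continuous_density hy' _ _ _).intervalIntegrable _ _)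
      change 0 ≤ Real.exp (-V y) * (r y * P y t ^ 2 + α y * Q y t ^ 2)
      positivity
    have s2 : ∫ t in L * β..T, c * Q L t ^ 2
        ≤ ∫ t in L * β..T, (Real.exp (-V y) * (r y * P y t ^ 2 + α y * Q y t ^ 2)
          + c * (2 * M * (r₁ * M)) * (L - y)) := intervalIntegral.integral_mono_on hT.le
      (((eQ L hL').const_mul c).intervalIntegrable (μ := volume) (L * β) T)
      (((hs.continuous_density hy' _ _ _).add continuous_const).intervalIntegrable _ _)
      (fun t ht => by
        have a2 := hs.abs_sub_Q_le hc (hLβ.trans ht.1) hy' hL'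
        rw [abs_of_nonneg (sub_nonneg.2 hy'.2)] at a2
        have b2 := sq_le_sq_add_of_abs_sub_le (hs.bound_snd L hL' t) (hs.bound_snd y hy' t) a2
        have d1 := mul_le_mul_of_nonneg_left b2 hcpos.le
        have d2 : c ≤ Real.exp (-V y) * α y :=
          mul_le_mul (Real.exp_le_exp.2 (by linarith [(hc.V_mem y).2])) (hc.α_mem y).1 hα₀.le
            (Real.exp_pos _).le
        have d3 := mul_le_mul_of_nonneg_right d2 (sq_nonneg (Q y t))
        have d4 : 0 ≤ Real.exp (-V y) * (r y * P y t ^ 2) := by positivity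
        linarith)
    rw [intervalIntegral.integral_const_mul, intervalIntegral.integral_add
      ((hs.continuous_density hy' _ _ _).intervalIntegrable _ _) intervalIntegrable_const,
      intervalIntegral.integral_const, smul_eq_mul] at s2
    have hk : (T - L * β) * (c * (2 * M * (r₁ * M)) * (L - y)) ≤ K₂ * (L - y) := by
      have : (T - L * β) * (c * (2 * M * (r₁ * M)) * (L - y))
          ≤ T * (c * (2 * M * (r₁ * M)) * (L - y)) := by
        refine mul_le_mul_of_nonneg_right (by linarith) ?_
        have := sub_nonneg.2 hy'.2
        positivity
      rw [hK₂]; linarith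
    linarith
  have key : c * (∫ t in L * β..T, Q L t ^ 2) ≤ r₁ * ∫ t in (0 : ℝ)..T, P 0 t ^ 2 := by
    refine le_of_forall_pos_le_add fun ε hε => ?_
    -- The bound `L / 2` places `x < d` to the left of `y > L - d`; the other bound keeps both
    -- comparison errors below `ε` in total.
    set d := min (L / 2) (ε / (K₁ + K₂ + 1)) with hd
    have hdpos : 0 < d := by positivity
    have hdL : d ≤ L / 2 := min_le_left _ _
    obtain ⟨x, hx, hxG⟩ := exists_of_ae_restrict_Ioo hdpos
      (ae_restrict_of_ae_restrict_of_subset (Ioo_subset_Ioo_right (by linarith)) hc.ae_mem)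
    obtain ⟨y, hy, hyG⟩ := exists_of_ae_restrict_Ioo (c := L - d) (d := L) (by linarith)
      (ae_restrict_of_ae_restrict_of_subset (Ioo_subset_Ioo_left (by linarith)) hc.ae_mem)
    have hE := hs.sidewiseEnergy_anti hc hT hxG hyG (by linarith [hx.2, hy.1])
    have h1 := up x hxG
    have h2 := low y hyG
    have h3 : (K₁ + K₂ + 1) * d ≤ ε := by
      have : d ≤ ε / (K₁ + K₂ + 1) := min_le_right _ _
      rw [le_div_iff₀ (by positivity)] at this
      linarith
    have h4 : K₁ * x ≤ K₁ * d := mul_le_mul_of_nonneg_left hx.2.le hK₁0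
    have h5 : K₂ * (L - y) ≤ K₂ * d := mul_le_mul_of_nonneg_left (by linarith [hy.1]) hK₂0
    linarith
  have e1 : Real.exp B * r₁ / α₀ * (∫ t in (0 : ℝ)..T, P 0 t ^ 2)
      = (r₁ * ∫ t in (0 : ℝ)..T, P 0 t ^ 2) / c := by
    rw [hcdef, Real.exp_neg]
    field_simp
  rw [e1, le_div_iff₀ hcpos]
  linarith

end IsSidewiseSolution

end

/-! ### Weak solutions as sidewise solutions, and mollified test functions. -/

section

open scoped Convolution

variable {L T β r₀ r₁ α₀ α₁ B : ℝ} {r α V : ℝ → ℝ} {G : Set ℝ} {ψ : ℝ → ℝ → ℝ} {h : ℝ → ℝ}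

/-- The regularization in time of a weak solution is a regular solution of the sidewise system. -/
theorem exists_isSidewiseSolution {s : HNegOne 0 T} {ρ a : ℝ → ℝ} (hL : 0 < L)
    (hc : IsBVCoeff L β r₀ r₁ α₀ α₁ B r α V G)
    (hsol : IsAdjointSolution L T ρ a s ψ) (htr : IsTraceAtZero T ψ h)
    (hh : IntegrableOn h (Ioo 0 T))
    (hψ : Integrable (fun p : ℝ × ℝ => ψ p.1 p.2) (volume.restrict (Ioo 0 L ×ˢ Ioo 0 T)))
    (hrρ : ∀ᵐ x ∂(volume.restrict (Ioo 0 L)), r x = ρ x)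
    (hαa : ∀ᵐ x ∂(volume.restrict (Ioo 0 L)), α x = (a x)⁻¹)
    {k : ℝ → ℝ} (hk : IsKernel k) :
    ∃ M, IsSidewiseSolution L T r α (mollValue L T r α ψ h k)
      (fun x t => -mollFlux L T r ψ (deriv k) x t)
      (fun x t => -mollValue L T r α ψ h (deriv k) x t)
      (mollFlux L T r ψ (deriv (deriv k))) M := by
  have hr := hc.measurable_r
  have hα := hc.measurable_α
  have bv := fun (k : ℝ → ℝ) (hk : IsKernel k) =>
    exists_bound_mollValue (α := α) hψ hr hc.abs_r_le hc.abs_α_le hh hk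
  have bf := fun (k : ℝ → ℝ) (hk : IsKernel k) => exists_bound_mollFlux hψ hr hc.abs_r_le hk
  obtain ⟨m₁, h₁⟩ := bv k hk
  obtain ⟨m₂, h₂⟩ := bf _ hk.deriv
  obtain ⟨m₃, h₃⟩ := bv _ hk.deriv
  obtain ⟨m₄, h₄⟩ := bf _ hk.deriv.deriv
  obtain ⟨m₅, h₅⟩ := bf _ hk.deriv.deriv.deriv
  obtain ⟨m₆, h₆⟩ := bv _ hk.deriv.deriv
  have h0 : (0 : ℝ) ∈ Icc 0 L := ⟨le_rfl, hL.le⟩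
  have p₁ := (abs_nonneg _).trans (h₁ 0 h0 0)
  have p₂ := (abs_nonneg _).trans (h₂ 0 h0 0)
  have p₃ := (abs_nonneg _).trans (h₃ 0 h0 0)
  have p₄ := (abs_nonneg _).trans (h₄ 0 h0 0)
  have p₅ := mul_nonneg ((abs_nonneg _).trans (hc.abs_α_le 0)) ((abs_nonneg _).trans (h₅ 0 h0 0))
  have p₆ := mul_nonneg ((abs_nonneg _).trans (hc.abs_r_le 0)) ((abs_nonneg _).trans (h₆ 0 h0 0))
  have cf := fun (k : ℝ → ℝ) (hk : IsKernel k) (t : ℝ) (c d : ℝ) =>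
    intervalIntegrable_mul_continuous hα hc.abs_α_le
      (continuous_mollFlux hψ hr hc.abs_r_le hk t) c d
  have cv : ∀ (k : ℝ → ℝ) (hk : IsKernel k) (t : ℝ) (c d : ℝ),
      IntervalIntegrable (fun x => r x * mollValue L T r α ψ h k x t) volume c d :=
    fun k hk t c d => intervalIntegrable_mul_continuous hr hc.abs_r_le
      (continuous_const.add (intervalIntegral.continuous_primitive (cf _ hk.deriv.deriv t) 0)) c d
  have dv := fun (k : ℝ → ℝ) (hk : IsKernel k) x (hx : x ∈ Icc 0 L) (t : ℝ) =>
    hasDerivAt_mollValue hψ hr hc.abs_r_le hα hc.abs_α_le hh hk hx t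
  have df := fun (k : ℝ → ℝ) (hk : IsKernel k) x (hx : x ∈ Icc 0 L) (t : ℝ) =>
    hasDerivAt_mollFlux hψ hr hc.abs_r_le hk hx t
  have sv : ∀ (k : ℝ → ℝ) (hk : IsKernel k) (t x y : ℝ),
      mollValue L T r α ψ h k y t - mollValue L T r α ψ h k x t
        = ∫ z in x..y, α z * mollFlux L T r ψ (deriv (deriv k)) z t := fun k hk t x y => by
    rw [← intervalIntegral.integral_interval_sub_left (cf _ hk.deriv.deriv t 0 y)
      (cf _ hk.deriv.deriv t 0 x)]
    simp only [mollValue]; ring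
  have sf : ∀ (k : ℝ → ℝ) (hk : IsKernel k) (t : ℝ) (_ : 0 ≤ t), ∀ x ∈ Icc 0 L, ∀ y ∈ Icc 0 L,
      mollFlux L T r ψ k y t - mollFlux L T r ψ k x t
        = ∫ z in x..y, r z * mollValue L T r α ψ h k z t := fun k hk t ht x hx y hy => by
    rw [← intervalIntegral.integral_interval_sub_left (cv _ hk t 0 y) (cv _ hk t 0 x),
      mollFlux_eq_integral_mollValue hL hsol htr hψ hr hc.abs_r_le hα hc.abs_α_le hrρ hαa hk ht hx,
      mollFlux_eq_integral_mollValue hL hsol htr hψ hr hc.abs_r_le hα hc.abs_α_le hrρ hαa hk ht hy]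
  -- Each time derivative replaces the kernel by minus its derivative, which fixes the signs of `Q`
  -- and `P_t`. The bound `M` depends on `k` but never enters the final constant. The last two
  -- summands are the Lipschitz constants in `x`.
  refine ⟨m₁ + m₂ + m₃ + m₄ + α₁ * m₅ + r₁ * m₆, dv k hk, fun x hx t => ?_, fun x hx => ?_,
    fun x hx => ?_, fun x hx t => (h₁ x hx t).trans (by linarith), fun x hx t => ?_,
    fun x hx t => ?_, fun x hx t => (h₄ x hx t).trans (by linarith), fun t ht x hx y hy => ?_,
    fun t ht x hx y hy => ?_, fun t _ x _ y _ => sv k hk t x y, fun t ht x hx y hy => ?_,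
    fun x _ => mollValue_right_eq_zero hk x⟩
  · have := (df _ hk.deriv x hx t).neg
    rw [neg_neg] at this
    exact this
  · exact (continuous_iff_continuousAt.2 fun t => (dv _ hk.deriv x hx t).continuousAt).neg
  · exact continuous_iff_continuousAt.2 fun t => (df _ hk.deriv.deriv x hx t).continuousAt
  · rw [abs_neg]; exact (h₂ x hx t).trans (by linarith)
  · rw [abs_neg]; exact (h₃ x hx t).trans (by linarith)
  · rw [← neg_sub', abs_neg, sv _ hk.deriv, ← Real.norm_eq_abs]
    refine (intervalIntegral.norm_integral_le_of_norm_le_const (C := α₁ * m₅) fun z hz => ?_).trans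
      (mul_le_mul_of_nonneg_right (by linarith) (abs_nonneg _))
    rw [norm_mul]
    exact mul_le_mul (hc.abs_α_le z) (h₅ z (uIcc_subset_Icc hx hy (uIoc_subset_uIcc hz)) t)
      (norm_nonneg _) ((abs_nonneg _).trans (hc.abs_α_le z))
  · rw [sf _ hk.deriv.deriv t ht x hx y hy, ← Real.norm_eq_abs]
    refine (intervalIntegral.norm_integral_le_of_norm_le_const (C := r₁ * m₆) fun z hz => ?_).trans
      (mul_le_mul_of_nonneg_right (by linarith) (abs_nonneg _))
    rw [norm_mul]
    exact mul_le_mul (hc.abs_r_le z) (h₆ z (uIcc_subset_Icc hx hy (uIoc_subset_uIcc hz)) t)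
      (norm_nonneg _) ((abs_nonneg _).trans (hc.abs_r_le z))
  · rw [← neg_sub', sf _ hk.deriv t ht x hx y hy, ← intervalIntegral.integral_neg]
    simp only [mul_neg]

/-- Averaging against a probability density is a contraction in `L²`. -/
theorem integral_average_sq_le {ζ : ℝ → ℝ} (hh : MemLp h 2 (volume.restrict (Ioo 0 T)))
    (hζ : IsKernel ζ) (hζ0 : ∀ t, 0 ≤ ζ t) (hζ1 : ∫ t, ζ t = 1) :
    ∫ t in Ioo 0 T, (∫ τ in Ioo 0 T, h τ * ζ (τ - t)) ^ 2 ≤ ∫ τ in Ioo 0 T, h τ ^ 2 := by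
  obtain ⟨C, hC⟩ := hζ.exists_bound
  have hζc := hζ.contDiff.continuous
  have hζi : Integrable ζ := hζc.integrable_of_hasCompactSupport hζ.hasCompactSupport
  have hh1 : IntegrableOn h (Ioo 0 T) := hh.integrable one_le_two
  have hh2 : IntegrableOn (fun τ => h τ ^ 2) (Ioo 0 T) := hh.integrable_sq
  have hcs : ∀ t, AEStronglyMeasurable (fun τ => ζ (τ - t)) (volume.restrict (Ioo 0 T)) :=
    fun t => (hζ.continuous_sub t).aestronglyMeasurable
  have i1 : ∀ t, IntegrableOn (fun τ => h τ * ζ (τ - t)) (Ioo 0 T) := fun t =>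
    hh1.mul_bdd (c := C) (hcs t) (Eventually.of_forall fun τ => hC _)
  have i2 : ∀ t, IntegrableOn (fun τ => h τ ^ 2 * ζ (τ - t)) (Ioo 0 T) := fun t =>
    hh2.mul_bdd (c := C) (hcs t) (Eventually.of_forall fun τ => hC _)
  have i3 : ∀ t, IntegrableOn (fun τ => ζ (τ - t)) (Ioo 0 T) := fun t =>
    (hζi.comp_sub_right t).integrableOn
  -- Jensen's inequality by expanding `∫ (h - m)² ζ ≥ 0`; near `T` the kernel has mass less than one
  -- on `(0, T)`, and an upper bound on the mass is enough.
  have hpt : ∀ t, (∫ τ in Ioo 0 T, h τ * ζ (τ - t)) ^ 2 ≤ ∫ τ in Ioo 0 T, h τ ^ 2 * ζ (τ - t) := by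
    intro t
    set m := ∫ τ in Ioo 0 T, h τ * ζ (τ - t) with hm
    have h1 : 0 ≤ ∫ τ in Ioo 0 T, (h τ - m) ^ 2 * ζ (τ - t) :=
      integral_nonneg fun τ => mul_nonneg (sq_nonneg _) (hζ0 _)
    have e : ∀ τ, (h τ - m) ^ 2 * ζ (τ - t)
        = h τ ^ 2 * ζ (τ - t) - 2 * m * (h τ * ζ (τ - t)) + m ^ 2 * ζ (τ - t) := fun τ => by ring
    simp only [e] at h1
    have i4 : IntegrableOn (fun τ => h τ ^ 2 * ζ (τ - t) - 2 * m * (h τ * ζ (τ - t))) (Ioo 0 T) :=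
      (i2 t).sub ((i1 t).const_mul _)
    rw [integral_add i4 ((i3 t).const_mul _), integral_sub (i2 t) ((i1 t).const_mul _),
      integral_const_mul, integral_const_mul, ← hm] at h1
    have h2 : ∫ τ in Ioo 0 T, ζ (τ - t) ≤ 1 := by
      rw [← hζ1, ← integral_sub_right_eq_self ζ t]
      exact setIntegral_le_integral (hζi.comp_sub_right t) (Eventually.of_forall fun τ => hζ0 _)
    nlinarith [mul_le_mul_of_nonneg_left h2 (sq_nonneg m)]
  have hprod : Integrable (fun p : ℝ × ℝ => h p.2 ^ 2 * ζ (p.2 - p.1))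
      ((volume.restrict (Ioo 0 T)).prod (volume.restrict (Ioo 0 T))) := by
    have : Integrable (fun p : ℝ × ℝ => (1 : ℝ) * h p.2 ^ 2)
      ((volume.restrict (Ioo 0 T)).prod (volume.restrict (Ioo 0 T))) :=
      (integrable_const (1 : ℝ)).mul_prod hh2
    simp only [one_mul] at this
    exact this.mul_bdd (c := C) (by fun_prop) (Eventually.of_forall fun p => hC _)
  calc ∫ t in Ioo 0 T, (∫ τ in Ioo 0 T, h τ * ζ (τ - t)) ^ 2
      ≤ ∫ t in Ioo 0 T, ∫ τ in Ioo 0 T, h τ ^ 2 * ζ (τ - t) :=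
        integral_mono_of_nonneg (Eventually.of_forall fun t => sq_nonneg _) hprod.integral_prod_left
          (Eventually.of_forall hpt)
    _ = ∫ τ in Ioo 0 T, ∫ t in Ioo 0 T, h τ ^ 2 * ζ (τ - t) := integral_integral_swap hprod
    _ ≤ ∫ τ in Ioo 0 T, h τ ^ 2 := by
        refine integral_mono_of_nonneg (Eventually.of_forall fun τ => integral_nonneg fun t =>
          mul_nonneg (sq_nonneg _) (hζ0 _)) hh2 (Eventually.of_forall fun τ => ?_)
        change ∫ t in Ioo 0 T, h τ ^ 2 * ζ (τ - t) ≤ h τ ^ 2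
        rw [integral_const_mul]
        have h2 : ∫ t in Ioo 0 T, ζ (τ - t) ≤ 1 := by
          rw [← hζ1, ← integral_sub_left_eq_self ζ volume τ]
          exact setIntegral_le_integral (hζi.comp_sub_left τ) (Eventually.of_forall fun t => hζ0 _)
        exact mul_le_of_le_one_right (sq_nonneg _) h2

/-- The convolution of a kernel with a test function. -/
noncomputable def mollify (ζ η : ℝ → ℝ) : ℝ → ℝ := ζ ⋆[ContinuousLinearMap.lsmul ℝ ℝ, volume] η

theorem mollify_apply (ζ η : ℝ → ℝ) (τ : ℝ) : mollify ζ η τ = ∫ t, ζ (τ - t) * η t := by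
  rw [mollify, convolution_eq_swap]; rfl

theorem mollify_contDiff {ζ η : ℝ → ℝ} (hζ : IsKernel ζ) (hη : Continuous η) :
    ContDiff ℝ ∞ (mollify ζ η) :=
  hζ.hasCompactSupport.contDiff_convolution_left _ hζ.contDiff hη.locallyIntegrable

theorem deriv_mollify_left {ζ η : ℝ → ℝ} (hζ : IsKernel ζ) (hη : Continuous η) :
    deriv (mollify ζ η) = mollify (deriv ζ) η := by
  ext τ
  exact (hζ.hasCompactSupport.hasDerivAt_convolution_left _ (hζ.contDiff.of_le (by simp))
    hη.locallyIntegrable τ).deriv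

theorem deriv_mollify_right {ζ η : ℝ → ℝ} (hζ : IsKernel ζ) (hη : ContDiff ℝ ∞ η)
    (hηc : HasCompactSupport η) : deriv (mollify ζ η) = mollify ζ (deriv η) := by
  ext τ
  exact (hηc.hasDerivAt_convolution_right _ hζ.contDiff.continuous.locallyIntegrable
    (hη.of_le (by simp)) τ).deriv

/-- The flux paired with a mollified test function is the mollified flux paired with the test
function. -/
theorem pairingFlux_mollify
    (hψ : Integrable (fun p : ℝ × ℝ => ψ p.1 p.2) (volume.restrict (Ioo 0 L ×ˢ Ioo 0 T)))
    (hr : Measurable r) (hr₁ : ∀ x, |r x| ≤ r₁) (hL : 0 ≤ L) {k η : ℝ → ℝ} (hk : IsKernel k)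
    (hη : Continuous η) (hηc : HasCompactSupport η) :
    pairingFlux L T r ψ (mollify k η) L = ∫ t, η t * mollFlux L T r ψ k L t := by
  obtain ⟨C, hC⟩ := hk.exists_bound
  have hηi : Integrable η := hη.integrable_of_hasCompactSupport hηc
  have hi := integrable_mul_coeff hψ hr hr₁ le_rfl
  have hprod : Integrable (fun q : ℝ × (ℝ × ℝ) => η q.1 * (ψ q.2.1 q.2.2 * r q.2.1)
      * k (q.2.2 - q.1)) (volume.prod (volume.restrict (Ioo 0 L ×ˢ Ioo 0 T))) := by
    refine (hηi.mul_prod hi).mul_bdd (c := C) ?_ (Eventually.of_forall fun p => hC _)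
    have := hk.contDiff.continuous
    exact Continuous.aestronglyMeasurable (by fun_prop)
  have e : ∀ t, η t * mollFlux L T r ψ k L t
      = ∫ p in Ioo 0 L ×ˢ Ioo 0 T, η t * (ψ p.1 p.2 * r p.1) * k (p.2 - t) := fun t => by
    rw [mollFlux_eq_setIntegral hψ hr hr₁ hk ⟨hL, le_rfl⟩, ← integral_const_mul]
    simp only [mul_assoc]
  simp only [e]
  rw [integral_integral_swap hprod, pairingFlux, ← setIntegral_Ioo_eq_intervalIntegral hL,
    ← setIntegral_mul_tensor hψ hr (fun x _ => hr₁ x) (mollify_contDiff hk hη).continuous]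
  congr 1; ext p
  rw [mollify_apply, ← mul_assoc, ← integral_const_mul]
  congr 1; ext t; ring

end

/-! ### Duality and removal of the regularization. -/

section

open scoped Convolution

theorem L2Line.norm_sq_eq {u : L2Line} {f : ℝ → ℝ} (h : (u : ℝ → ℝ) =ᵐ[volume] f) :
    ‖u‖ ^ 2 = ∫ t, f t ^ 2 := by
  rw [← real_inner_self_eq_norm_sq, L2.inner_def]
  apply integral_congr_ae
  filter_upwards [h] with t ht
  rw [ht, real_inner_self_eq_norm_sq, Real.norm_eq_abs, sq_abs]

theorem integral_sq_le_of_abs_le {f : ℝ → ℝ} {T ε : ℝ} (hT : 0 ≤ T)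
    (hf : ∀ t, |f t| ≤ ε) (hs : ∀ t, t ∉ Ioo 0 T → f t = 0) :
    ∫ t, f t ^ 2 ≤ ε ^ 2 * T := by
  have e : (fun t => f t ^ 2) = (Ioo 0 T).indicator fun t => f t ^ 2 := by
    ext t
    by_cases ht : t ∈ Ioo 0 T
    · rw [indicator_of_mem ht]
    · rw [indicator_of_notMem ht, hs t ht]; simp
  rw [e, integral_indicator measurableSet_Ioo]
  have := norm_setIntegral_le_of_norm_le_const (μ := volume) (s := Ioo 0 T) (C := ε ^ 2)
    (f := fun t => f t ^ 2) (by simp) (fun t _ => by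
      rw [norm_pow, Real.norm_eq_abs]
      exact pow_le_pow_left₀ (abs_nonneg _) (hf t) 2)
  rw [Measure.real, Real.volume_Ioo, sub_zero, ENNReal.toReal_ofReal hT] at this
  exact (le_abs_self _).trans this

/-- Cauchy–Schwarz, from the discriminant of the nonnegative quadratic `x ↦ ∫ (x f + g)²`. -/
theorem sq_intervalIntegral_mul_le {f g : ℝ → ℝ} {c d : ℝ} (hcd : c ≤ d) (hf : Continuous f)
    (hg : Continuous g) :
    (∫ t in c..d, f t * g t) ^ 2 ≤ (∫ t in c..d, f t ^ 2) * ∫ t in c..d, g t ^ 2 := by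
  have h : ∀ x : ℝ, 0 ≤ (∫ t in c..d, f t ^ 2) * (x * x) + (2 * ∫ t in c..d, f t * g t) * x
      + ∫ t in c..d, g t ^ 2 := by
    intro x
    have h0 : 0 ≤ ∫ t in c..d, (f t * x + g t) ^ 2 :=
      intervalIntegral.integral_nonneg hcd fun t _ => sq_nonneg _
    have e : ∀ t, (f t * x + g t) ^ 2
        = f t ^ 2 * (x * x) + f t * g t * (2 * x) + g t ^ 2 := fun t => by ring
    simp only [e] at h0
    rw [intervalIntegral.integral_add (Continuous.intervalIntegrable (by fun_prop) _ _)
        (Continuous.intervalIntegrable (by fun_prop) _ _),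
      intervalIntegral.integral_add (Continuous.intervalIntegrable (by fun_prop) _ _)
        (Continuous.intervalIntegrable (by fun_prop) _ _), intervalIntegral.integral_mul_const,
      intervalIntegral.integral_mul_const] at h0
    linarith
  have := discrim_le_zero h
  rw [discrim] at this
  linarith

theorem mem_H10_of_mem_smoothPairs {c d : ℝ} {p : L2Pair} (hp : p ∈ smoothPairs c d) :
    p ∈ H10 c d :=
  Submodule.le_topologicalClosure _ (Submodule.subset_span hp)

theorem smoothPairs_mono {c c' d : ℝ} (h : c' ≤ c) : smoothPairs c d ⊆ smoothPairs c' d :=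
  fun _ ⟨φ, h1, h2, h3, h4⟩ => ⟨φ, h1, h2, h3.trans (Ioo_subset_Ioo_left h), h4⟩

/-- Since the pairs already form a subspace, every element of `H10` is a limit of genuine test
functions, not just of linear combinations of them. -/
theorem span_smoothPairs_subset (c d : ℝ) :
    (Submodule.span ℝ (smoothPairs c d) : Set L2Pair) ⊆ smoothPairs c d := by
  intro p hp
  induction hp using Submodule.span_induction with
  | mem p hp => exact hp
  | zero =>
    refine ⟨0, contDiff_const, HasCompactSupport.zero, by simp [tsupport], ?_, ?_⟩
    · exact Lp.coeFn_zero ℝ 2 volume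
    · have : deriv (0 : ℝ → ℝ) = 0 := by ext t; exact deriv_const t 0
      rw [this]
      exact Lp.coeFn_zero ℝ 2 volume
  | add p q _ _ hp hq =>
    obtain ⟨φ, a1, a2, a3, a4, a5⟩ := hp
    obtain ⟨θ, b1, b2, b3, b4, b5⟩ := hq
    refine ⟨φ + θ, a1.add b1, a2.add b2, (tsupport_add φ θ).trans (union_subset a3 b3), ?_, ?_⟩
    · exact (Lp.coeFn_add p.fst q.fst).trans (a4.add b4)
    · have : deriv (φ + θ) = deriv φ + deriv θ := by
        ext t
        exact deriv_add (a1.differentiable (by simp) t) (b1.differentiable (by simp) t)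
      rw [this]
      exact (Lp.coeFn_add p.snd q.snd).trans (a5.add b5)
  | smul x p _ hp =>
    obtain ⟨φ, a1, a2, a3, a4, a5⟩ := hp
    refine ⟨x • φ, contDiff_const.smul a1, a2.smul_left (f := fun _ => x),
      (closure_mono (Function.support_const_smul_subset x φ)).trans a3, ?_, ?_⟩
    · exact (Lp.coeFn_smul x p.fst).trans (a4.const_smul x)
    · have : deriv (x • φ) = x • deriv φ := by
        ext t
        exact deriv_const_smul x (a1.differentiable (by simp) t)
      rw [this]
      exact (Lp.coeFn_smul x p.snd).trans (a5.const_smul x)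

theorem exists_mem_smoothPairs {c d : ℝ} {η : ℝ → ℝ} (hη : ContDiff ℝ ∞ η)
    (hηc : HasCompactSupport η) (hηs : tsupport η ⊆ Ioo c d) :
    ∃ p ∈ smoothPairs c d, (p.fst : ℝ → ℝ) =ᵐ[volume] η ∧ (p.snd : ℝ → ℝ) =ᵐ[volume] deriv η := by
  have h1 : MemLp η 2 volume := hη.continuous.memLp_of_hasCompactSupport hηc
  have h2 : MemLp (deriv η) 2 volume :=
    (hη.continuous_deriv (by simp)).memLp_of_hasCompactSupport hηc.deriv
  exact ⟨WithLp.toLp 2 (h1.toLp η, h2.toLp (deriv η)),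
    ⟨η, hη, hηc, hηs, h1.coeFn_toLp, h2.coeFn_toLp⟩, h1.coeFn_toLp, h2.coeFn_toLp⟩

/-- Smooth probability densities supported in a short interval to the right of `0`. -/
theorem exists_isKernel {δ : ℝ} (hδ : 0 < δ) :
    ∃ ζ, IsKernel ζ ∧ (∀ t, 0 ≤ ζ t) ∧ ∫ t, ζ t = 1 ∧ Function.support ζ ⊆ Metric.ball 0 δ := by
  let b : ContDiffBump (δ / 2) := ⟨δ / 8, δ / 4, by positivity, by linarith⟩
  refine ⟨b.normed volume, ⟨b.contDiff_normed, b.hasCompactSupport_normed, ?_⟩, b.nonneg_normed,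
    b.integral_normed, ?_⟩
  · rw [b.tsupport_normed_eq]
    intro t ht
    rw [Metric.mem_closedBall, Real.dist_eq, abs_le] at ht
    change 0 < t
    have : b.rOut = δ / 4 := rfl
    linarith [ht.1]
  · rw [b.support_normed_eq]
    intro t ht
    rw [Metric.mem_ball, Real.dist_eq, abs_lt] at ht ⊢
    have : b.rOut = δ / 4 := rfl
    constructor <;> linarith [ht.1, ht.2]

theorem tsupport_mollify_subset {ζ η : ℝ → ℝ} {δ : ℝ}
    (hζ : Function.support ζ ⊆ Metric.ball 0 δ) :
    tsupport (mollify ζ η) ⊆ Metric.cthickening δ (tsupport η) := by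
  refine closure_minimal (fun t ht => ?_) Metric.isClosed_cthickening
  obtain ⟨u, hu, v, hv, rfl⟩ := support_convolution_subset _ ht
  refine Metric.mem_cthickening_of_dist_le _ v _ _ (subset_tsupport η hv) ?_
  have := hζ hu
  rw [Metric.mem_ball, dist_zero_right] at this
  simpa [dist_eq_norm] using this.le

theorem abs_mollify_sub_le {ζ η : ℝ → ℝ} {δ ε : ℝ} (hε : 0 ≤ ε)
    (hζ : Function.support ζ ⊆ Metric.ball 0 δ) (hζ0 : ∀ t, 0 ≤ ζ t) (hζ1 : ∫ t, ζ t = 1)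
    (hη : Continuous η) (hηε : ∀ s t, dist s t < δ → dist (η s) (η t) ≤ ε) (t : ℝ) :
    |mollify ζ η t - η t| ≤ ε :=
  dist_convolution_le hε hζ hζ0 hζ1 hη.aestronglyMeasurable fun s hs => hηε s t hs

variable {L T β r₀ r₁ α₀ α₁ B : ℝ} {r α V : ℝ → ℝ} {G : Set ℝ} {ψ : ℝ → ℝ → ℝ} {h : ℝ → ℝ}

/-- The estimate for mollified test functions. -/
theorem sq_leftLim_mul_le {s : HNegOne 0 T} {ρ a : ℝ → ℝ} (hL : 0 < L)
    (hc : IsBVCoeff L β r₀ r₁ α₀ α₁ B r α V G) (hβ : 0 ≤ β) (hT : L * β < T)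
    (hsol : IsAdjointSolution L T ρ a s ψ) (htr : IsTraceAtZero T ψ h)
    (hrρ : ∀ᵐ x ∂(volume.restrict (Ioo 0 L)), r x = ρ x)
    (hαa : ∀ᵐ x ∂(volume.restrict (Ioo 0 L)), α x = (a x)⁻¹)
    {ζ η : ℝ → ℝ} (hζ : IsKernel ζ) (hζ0 : ∀ t, 0 ≤ ζ t) (hζ1 : ∫ t, ζ t = 1)
    (hη : ContDiff ℝ ∞ η) (hηc : HasCompactSupport η) (hηs : tsupport η ⊆ Ioo (L * β) T)
    (hms : tsupport (mollify ζ η) ⊆ Ioi 0) (φ : H10 0 T)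
    (hφ : ((φ : L2Pair).fst : ℝ → ℝ) =ᵐ[volume] mollify ζ η) :
    (Function.leftLim a L * s φ) ^ 2
      ≤ (∫ t, deriv η t ^ 2) * (Real.exp B * r₁ / α₀ * ∫ t in Ioo 0 T, h t ^ 2) := by
  have hψ : Integrable (fun p : ℝ × ℝ => ψ p.1 p.2) (volume.restrict (Ioo 0 L ×ˢ Ioo 0 T)) := by
    have : IsFiniteMeasure ((volume : Measure (ℝ × ℝ)).restrict (Ioo 0 L ×ˢ Ioo 0 T)) := by
      rw [volume_restrict_prod]; infer_instance
    exact hsol.memLp.integrable one_le_two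
  have hh : IntegrableOn h (Ioo 0 T) := htr.memLp.integrable one_le_two
  have hηC := hη.continuous
  have hη'C : Continuous (deriv η) := hη.continuous_deriv (by simp)
  have hT0 : 0 ≤ T := (mul_nonneg hL.le hβ).trans hT.le
  have hLmem : L ∈ Icc 0 L := ⟨hL.le, le_rfl⟩
  obtain ⟨M, hs⟩ := exists_isSidewiseSolution hL hc hsol htr hh hψ hrρ hαa hζ
  have hK : 0 ≤ Real.exp B * r₁ / α₀ := by
    have := hc.α₀_pos
    have := (abs_nonneg _).trans (hc.abs_r_le 0)
    positivity
  have hout : ∀ t, t ∉ Ioo (L * β) T → η t = 0 := fun t ht =>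
    image_eq_zero_of_notMem_tsupport fun h => ht (hηs h)
  have hout' : ∀ t, t ∉ Ioo (L * β) T → deriv η t = 0 := fun t ht =>
    image_eq_zero_of_notMem_tsupport fun h => ht (hηs (tsupport_deriv_subset (𝕜 := ℝ) h))
  set Q := fun t => -mollFlux L T r ψ (deriv ζ) L t with hQ
  have hQc : Continuous Q := hs.continuous_Q hLmem
  -- Both derivatives of `ζ ⋆ η` fall on the kernel, so the source pairs as `∫ η Q_t`. Integrating
  -- by parts costs one derivative of `η`, which is why the dual norm of `H¹₀` appears.
  have e1 : Function.leftLim a L * s φ = -∫ t in L * β..T, deriv η t * Q t := by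
    rw [← hsol.pairingFlux_right hL hψ hc.measurable_r hc.abs_r_le hrρ
      (mollify_contDiff hζ hηC) hms φ (ae_restrict_of_ae hφ), deriv_mollify_left hζ hηC,
      deriv_mollify_left hζ.deriv hηC,
      pairingFlux_mollify hψ hc.measurable_r hc.abs_r_le hL.le hζ.deriv.deriv hηC hηc,
      ← intervalIntegral.integral_eq_integral_of_support_subset (a := L * β) (b := T),
      intervalIntegral.integral_mul_deriv_eq_deriv_mul (u := η) (u' := deriv η) (v := Q)
        (fun t _ => (hη.differentiable (by simp) t).hasDerivAt)
        (fun t _ => hs.hasDerivAt_snd L hLmem t) (hη'C.intervalIntegrable _ _)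
        ((hs.continuous_snd L hLmem).intervalIntegrable _ _),
      hout T (by simp), hout (L * β) (by simp)]
    · simp
    · intro t ht
      by_contra h'
      exact ht (by simp [hout t fun h => h' (Ioo_subset_Ioc_self h)])
  have e2 : ∫ t in L * β..T, deriv η t ^ 2 = ∫ t, deriv η t ^ 2 := by
    apply intervalIntegral.integral_eq_integral_of_support_subset
    intro t ht
    by_contra h'
    exact ht (by simp [hout' t fun h => h' (Ioo_subset_Ioc_self h)])
  have e3 := hs.integral_sq_le hc hL hT (by simp [mollFlux, pairingFlux])
  have e4 := integral_average_sq_le htr.memLp hζ hζ0 hζ1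
  have e5 : ∀ t, mollValue L T r α ψ h ζ 0 t = ∫ τ in Ioo 0 T, h τ * ζ (τ - t) := fun t => by
    simp [mollValue]
  simp only [e5] at e3
  rw [← setIntegral_Ioo_eq_intervalIntegral hT0] at e3
  rw [e1, neg_sq, ← e2]
  refine (sq_intervalIntegral_mul_le hT.le hη'C hQc).trans (mul_le_mul_of_nonneg_left ?_ ?_)
  · exact e3.trans (mul_le_mul_of_nonneg_left e4 hK)
  · exact intervalIntegral.integral_nonneg hT.le fun t _ => sq_nonneg _

/-- The estimate for smooth test functions. -/
theorem leftLim_mul_abs_le_of_mem_smoothPairs {s : HNegOne 0 T} {ρ a : ℝ → ℝ} (hL : 0 < L)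
    (hc : IsBVCoeff L β r₀ r₁ α₀ α₁ B r α V G) (hβ : 0 ≤ β) (hT : L * β < T)
    (hsol : IsAdjointSolution L T ρ a s ψ) (htr : IsTraceAtZero T ψ h)
    (hrρ : ∀ᵐ x ∂(volume.restrict (Ioo 0 L)), r x = ρ x)
    (hαa : ∀ᵐ x ∂(volume.restrict (Ioo 0 L)), α x = (a x)⁻¹)
    (φ : H10 0 T) (hφ : (φ : L2Pair) ∈ smoothPairs (L * β) T) :
    |Function.leftLim a L * s φ|
      ≤ √(Real.exp B * r₁ / α₀ * ∫ t in Ioo 0 T, h t ^ 2) * ‖φ‖ := by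
  obtain ⟨η, hη, hηc, hηs, hφ1, hφ2⟩ := hφ
  have hLβ : 0 ≤ L * β := mul_nonneg hL.le hβ
  have hT0 : 0 ≤ T := hLβ.trans hT.le
  have hηC := hη.continuous
  have hη'C : Continuous (deriv η) := hη.continuous_deriv (by simp)
  have hα₀ := hc.α₀_pos
  have hr₁ := (abs_nonneg _).trans (hc.abs_r_le 0)
  set J := Real.exp B * r₁ / α₀ * ∫ t in Ioo 0 T, h t ^ 2 with hJ
  have hJ0 : 0 ≤ J := mul_nonneg (by positivity) (integral_nonneg fun t => sq_nonneg _)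
  have hsq : ∀ p : L2Pair, ‖p‖ ^ 2 = ‖p.fst‖ ^ 2 + ‖p.snd‖ ^ 2 := WithLp.prod_norm_sq_eq_of_L2
  have hsnd : ∫ t, deriv η t ^ 2 ≤ ‖φ‖ ^ 2 := by
    rw [← L2Line.norm_sq_eq hφ2, Submodule.coe_norm, hsq]
    linarith [sq_nonneg ‖(φ : L2Pair).fst‖]
  have key : ∀ ε : ℝ, 0 < ε → |Function.leftLim a L * s φ|
      ≤ √J * ‖φ‖ + |Function.leftLim a L| * ‖s‖ * √(2 * T) * ε := by
    intro ε hε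
    -- `δ₀` keeps the mollified support inside `(Lβ, T)`; `δ₁` and `δ₂` make `η` and `η'` uniformly
    -- `ε`-close to their mollifications.
    obtain ⟨δ₀, hδ₀, hsub⟩ := hηc.isCompact.exists_cthickening_subset_open isOpen_Ioo hηs
    obtain ⟨δ₁, hδ₁, hu₁⟩ := Metric.uniformContinuous_iff.1
      (hηc.uniformContinuous_of_continuous hηC) ε hε
    obtain ⟨δ₂, hδ₂, hu₂⟩ := Metric.uniformContinuous_iff.1
      (hηc.deriv.uniformContinuous_of_continuous hη'C) ε hε
    set δ := min δ₀ (min δ₁ δ₂) with hδ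
    obtain ⟨ζ, hζ, hζ0, hζ1, hζs⟩ := exists_isKernel (δ := δ) (by positivity)
    have hcth : Metric.cthickening δ (tsupport η) ⊆ Ioo (L * β) T :=
      (Metric.cthickening_mono (min_le_left _ _) _).trans hsub
    have hms : tsupport (mollify ζ η) ⊆ Ioo (L * β) T := (tsupport_mollify_subset hζs).trans hcth
    have hms' : tsupport (mollify ζ η) ⊆ Ioo 0 T := hms.trans (Ioo_subset_Ioo_left hLβ)
    have hmc : HasCompactSupport (mollify ζ η) :=
      hηc.isCompact.cthickening.of_isClosed_subset (isClosed_tsupport _)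
        (tsupport_mollify_subset hζs)
    obtain ⟨q, hq, hq1, hq2⟩ := exists_mem_smoothPairs (mollify_contDiff hζ hηC) hmc hms'
    rw [deriv_mollify_right hζ hη hηc] at hq2
    set φ' : H10 0 T := ⟨q, mem_H10_of_mem_smoothPairs hq⟩ with hφ'
    have b1 := sq_leftLim_mul_le hL hc hβ hT hsol htr hrρ hαa hζ hζ0 hζ1 hη hηc hηs
      (hms'.trans fun t ht => ht.1) φ' hq1
    have b2 : |Function.leftLim a L * s φ'| ≤ √J * ‖φ‖ := by
      refine abs_le_of_sq_le_sq (b1.trans ?_) (by positivity)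
      rw [mul_pow, Real.sq_sqrt hJ0, mul_comm]
      exact mul_le_mul_of_nonneg_left hsnd hJ0
    have hz : ∀ t, t ∉ Ioo 0 T → η t = 0 := fun t ht => image_eq_zero_of_notMem_tsupport
      fun h => ht (Ioo_subset_Ioo_left hLβ (hηs h))
    have hz' : ∀ t, t ∉ Ioo 0 T → deriv η t = 0 := fun t ht => image_eq_zero_of_notMem_tsupport
      fun h => ht (Ioo_subset_Ioo_left hLβ (hηs (tsupport_deriv_subset (𝕜 := ℝ) h)))
    have hzm : ∀ t, t ∉ Ioo 0 T → mollify ζ η t = 0 := fun t ht =>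
      image_eq_zero_of_notMem_tsupport fun h => ht (hms' h)
    have hzm' : ∀ t, t ∉ Ioo 0 T → mollify ζ (deriv η) t = 0 := fun t ht => by
      rw [← deriv_mollify_right hζ hη hηc]
      exact image_eq_zero_of_notMem_tsupport fun h => ht (hms' (tsupport_deriv_subset (𝕜 := ℝ) h))
    -- The function and its derivative each contribute at most `ε² T` to the squared norm.
    have n1 : ‖φ' - φ‖ ≤ √(2 * T) * ε := by
      refine abs_le_of_sq_le_sq' ?_ (by positivity) |>.2
      rw [Submodule.coe_norm, hsq, mul_pow, Real.sq_sqrt (by positivity)]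
      have c1 : ((((φ' - φ : H10 0 T) : L2Pair).fst : L2Line) : ℝ → ℝ)
          =ᵐ[volume] fun t => mollify ζ η t - η t :=
        (Lp.coeFn_sub q.fst (φ : L2Pair).fst).trans (hq1.sub hφ1)
      have c2 : ((((φ' - φ : H10 0 T) : L2Pair).snd : L2Line) : ℝ → ℝ)
          =ᵐ[volume] fun t => mollify ζ (deriv η) t - deriv η t :=
        (Lp.coeFn_sub q.snd (φ : L2Pair).snd).trans (hq2.sub hφ2)
      rw [L2Line.norm_sq_eq c1, L2Line.norm_sq_eq c2]
      have d1 := integral_sq_le_of_abs_le hT0 (abs_mollify_sub_le hε.le hζs hζ0 hζ1 hηC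
        fun x y hxy => (hu₁ (hxy.trans_le ((min_le_right _ _).trans (min_le_left _ _)))).le)
        (fun t ht => by rw [hz t ht, hzm t ht, sub_zero])
      have d2 := integral_sq_le_of_abs_le hT0 (abs_mollify_sub_le hε.le hζs hζ0 hζ1 hη'C
        fun x y hxy => (hu₂ (hxy.trans_le ((min_le_right _ _).trans (min_le_right _ _)))).le)
        (fun t ht => by rw [hz' t ht, hzm' t ht, sub_zero])
      linarith
    have e : Function.leftLim a L * s φ
        = Function.leftLim a L * s φ' - Function.leftLim a L * s (φ' - φ) := by
      rw [map_sub]; ring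
    rw [e]
    refine (abs_sub _ _).trans (add_le_add b2 ?_)
    rw [abs_mul, mul_assoc, mul_assoc]
    refine mul_le_mul_of_nonneg_left ?_ (abs_nonneg _)
    exact (s.le_opNorm _).trans (mul_le_mul_of_nonneg_left n1 s.opNorm_nonneg)
  set D := |Function.leftLim a L| * ‖s‖ * √(2 * T) with hD
  have hD0 : 0 ≤ D := by positivity
  refine le_of_forall_pos_le_add fun ε hε => ?_
  have h1 := key (ε / (D + 1)) (by positivity)
  have h2 : D * (ε / (D + 1)) ≤ ε := by
    rw [mul_div_assoc', div_le_iff₀ (by positivity)]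
    nlinarith
  linarith

theorem norm_comp_subtypeL_le {E : Type*} [NormedAddCommGroup E] [NormedSpace ℝ E]
    {K : Submodule ℝ E} (f : StrongDual ℝ E) {c : ℝ} (hc : 0 ≤ c) (h : ∀ x ∈ K, |f x| ≤ c * ‖x‖) :
    ‖f.comp K.subtypeL‖ ≤ c :=
  ContinuousLinearMap.opNorm_le_bound _ hc fun x => h x x.2

theorem toReal_eLpNorm_two_eq {T : ℝ} (hh : MemLp h 2 (volume.restrict (Ioo 0 T))) :
    (eLpNorm h 2 (volume.restrict (Ioo 0 T))).toReal = √(∫ t in Ioo 0 T, h t ^ 2) := by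
  rw [hh.eLpNorm_eq_integral_rpow_norm two_ne_zero ENNReal.ofNat_ne_top,
    ENNReal.toReal_ofReal (by positivity), Real.sqrt_eq_rpow]
  simp

end

/-! ### The observability inequality. -/

theorem proposition3p1 (L ρ₀ ρ₁ a₀ a₁ T : ℝ) (ρ a : ℝ → ℝ)
    (hL : 0 < L) (hρ₀ : 0 < ρ₀) (ha₀ : 0 < a₀)
    (hρBV : BoundedVariationOn ρ (Ioo 0 L)) (haBV : BoundedVariationOn a (Ioo 0 L))
    (hρ : ∀ᵐ x ∂(volume.restrict (Ioo 0 L)), ρ₀ ≤ ρ x ∧ ρ x ≤ ρ₁)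
    (ha : ∀ᵐ x ∂(volume.restrict (Ioo 0 L)), a₀ ≤ a x ∧ a x ≤ a₁)
    (hT : L * slowness L ρ a < T) :
    ∃ C : ℝ, 0 < C ∧
      ∀ (s : HNegOne 0 T) (ψ : ℝ → ℝ → ℝ) (h : ℝ → ℝ),
        SupportedAfter s (L * slowness L ρ a) →
        IsAdjointSolution L T ρ a s ψ →
        IsTraceAtZero T ψ h →
        hNegOneNormOn s (L * slowness L ρ a)
          ≤ C * (eLpNorm h 2 (volume.restrict (Ioo 0 T))).toReal := by
  obtain ⟨r, α, V, G, B, hr, hα, hrb, hαb, hrρ, hαa, hG, hGae, hV, hsp, hvar⟩ :=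
    exists_coefficients hL hρ₀ ha₀ hρBV haBV hρ ha
  obtain ⟨x₀, -, hx₀, hx₁⟩ := exists_of_ae_restrict_Ioo hL (hGae.and ha)
  have ha₁ : 0 < a₁ := by linarith [hx₁.1, hx₁.2]
  have hρ₁ : 0 < ρ₁ := hρ₀.trans_le ((hrb 0).1.trans (hrb 0).2)
  have hβ : 0 ≤ slowness L ρ a := (Real.sqrt_nonneg _).trans (hsp x₀ hx₀)
  have hc : IsBVCoeff L (slowness L ρ a) ρ₀ ρ₁ a₁⁻¹ a₀⁻¹ B r α V G :=
    ⟨hρ₀, inv_pos.2 ha₁, hr, hα, hrb, hαb, hG, hGae, hV, hsp, hvar⟩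
  have hleft : a₀ ≤ Function.leftLim a L :=
    le_leftLim_of_ae_le hL haBV (ha.mono fun x hx => hx.1)
  have hleft0 : 0 < Function.leftLim a L := ha₀.trans_le hleft
  -- The square root of the energy constant with `α₀ = a₁⁻¹`, divided by `a(L⁻)`; it involves the
  -- coefficients only.
  refine ⟨√(Real.exp B * ρ₁ / a₁⁻¹) / Function.leftLim a L, by positivity,
    fun s ψ h _ hsol htr => ?_⟩
  rw [toReal_eLpNorm_two_eq htr.memLp]
  set c := √(Real.exp B * ρ₁ / a₁⁻¹) / Function.leftLim a L * √(∫ t in Ioo 0 T, h t ^ 2) with hcdef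
  have hsmooth : ∀ φ : H10 0 T, (φ : L2Pair) ∈ smoothPairs (L * slowness L ρ a) T →
      |s φ| ≤ c * ‖φ‖ := by
    intro φ hφ
    have h1 := leftLim_mul_abs_le_of_mem_smoothPairs hL hc hβ hT hsol htr hrρ hαa φ hφ
    rw [abs_mul, abs_of_pos hleft0, Real.sqrt_mul (by positivity)] at h1
    rw [hcdef, div_mul_eq_mul_div, div_mul_eq_mul_div, le_div_iff₀ hleft0]
    linarith
  -- Density: the smooth approximants of `φ` also lie in `H¹₀(0, T)` because `Lβ ≥ 0`, so continuity
  -- of `s` carries the bound to the limit.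
  refine norm_comp_subtypeL_le s (by positivity) fun φ hφ => ?_
  have hφ' : (φ : L2Pair) ∈ closure
      (Submodule.span ℝ (smoothPairs (L * slowness L ρ a) T) : Set L2Pair) := hφ
  obtain ⟨p, hp, hlim⟩ := mem_closure_iff_seq_limit.1 hφ'
  have hps := fun n => span_smoothPairs_subset _ _ (hp n)
  let q : ℕ → H10 0 T := fun n => ⟨p n, mem_H10_of_mem_smoothPairs
    (smoothPairs_mono (mul_nonneg hL.le hβ) (hps n))⟩
  have hq : Tendsto q atTop (𝓝 φ) := tendsto_subtype_rng.2 hlim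
  exact le_of_tendsto_of_tendsto' ((s.continuous.tendsto φ).comp hq).abs
    (hq.norm.const_mul c) fun n => hsmooth (q n) (hps n)
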